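/- **Theorem.** Let $G$ be a finite group and $H$ a subgroup such that the interval $[H,G]=\{K : H\le K\le G\}$ of the subgroup lattice of $G$ is Boolean of rank $n\ge 0$ (isomorphic to the lattice of subsets of an $n$-element set). Assume that $[H,G]$ is group-complemented: $KK^{\complement}=G$ for every $K\in[H,G]$, where $K^{\complement}$ is the lattice complement of $K$ in $[H,G]$ (so $K\cap K^{\complement}=H$ and $\langle K,K^{\complement}\rangle=G$). Let $C(H,G)$ be the poset of right cosets $Kg$ with $H\le K<G$ and $g\in G$, ordered by inclusion, and let $\hat C(H,G)=C(H,G)\sqcup\{\emptyset,G\}$. For a finite poset $P$, let $\Delta(P)$ be its order complex (its faces are the chains of $P$, including the empty one, of dimension $-1$), and let $\tilde\beta_i(\Delta(P))$, $i\in\mathbb Z$, be the dimension of its $i$-th reduced simplicial homology over $\mathbb C$. Put $$\varphi(H,G)=\#\{Hg : g\in G,\ \langle Hg\rangle=G\},\qquad \hat\varphi(H,G)=\sum_{K\in[H,G]}\mu(H,K)\,|G:K|,$$ where $\mu$ is the Möbius function of $[H,G]$. Then: 1. $\hat C(H,G)$ is Cohen–Macaulay over $\mathbb C$: it is graded (it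 has a minimum and a maximum, and all its maximal chains have the same length), and for all $x<y$ in $\hat C(H,G)$ the open interval $(x,y)$ satisfies $\tilde\beta_i(\Delta((x,y)))=0$ for every $i<\dim\Delta((x,y))$. 2. $\dim\Delta(C(H,G))=n-1$, $\tilde\beta_i(\Delta(C(H,G)))=0$ for every $i\ne n-1$, and $$\tilde\beta_{n-1}(\Delta(C(H,G)))=\hat\varphi(H,G)=\varphi(H,G)\neq 0.$$ -/

import Mathlib

open scoped Pointwise

noncomputable section

/-! ### Order complexes and reduced simplicial homology -/

section OrderComplex

variable (k : Type*) [Field k] (P : Type*) [PartialOrder P]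

/-- Strict chains `x₀ < ⋯ < xₙ₋₁` with `n` elements, i.e. the `(n - 1)`-dimensional faces of the
order complex `Δ(P)` (for `n = 0`, the empty face). -/
abbrev PosetChain (n : ℕ) : Type _ := Fin n ↪o P

variable {P} in
/-- The face `x₀ < ⋯ < x̂ᵢ < ⋯ < xₙ`, with the `i`-th element removed. -/
def PosetChain.face {n : ℕ} (c : PosetChain P (n + 1)) (i : Fin (n + 1)) : PosetChain P n :=
  (Fin.succAboveOrderEmb i).trans c

/-- The space of simplicial `(n - 1)`-chains of `Δ(P)` over the field `k`, with basis the strict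
chains of `P` with `n` elements. -/
abbrev ChainSpace (n : ℕ) := PosetChain P n →₀ k

instance (n : ℕ) : AddCommGroup (ChainSpace k P n) := Finsupp.instAddCommGroup

/-- The simplicial boundary map, from degree `n` (chains with `n + 1` elements) to degree `n - 1`
(chains with `n` elements). For `n = 0` it is the augmentation. -/
def posetBoundary (n : ℕ) : ChainSpace k P (n + 1) →ₗ[k] ChainSpace k P n :=
  Finsupp.linearCombination k fun c : PosetChain P (n + 1) =>
    ∑ i : Fin (n + 1), (-1 : k) ^ (i : ℕ) • Finsupp.single (c.face i) 1

/-- The cycles in degree `n - 1`. In degree `-1` everything is a cycle. -/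
def posetCycles : (n : ℕ) → Submodule k (ChainSpace k P n)
  | 0 => ⊤
  | n + 1 => LinearMap.ker (posetBoundary k P n)

/-- The reduced simplicial homology space of `Δ(P)` over `k` in degree `n - 1`:
cycles modulo boundaries. -/
abbrev ReducedHomology (n : ℕ) :=
  posetCycles k P n ⧸ (LinearMap.range (posetBoundary k P n)).submoduleOf (posetCycles k P n)

/-- The `i`-th reduced Betti number of `Δ(P)` over `k`, for an integer `i`
(all the reduced homology lives in degrees `i ≥ -1`). -/
def reducedBetti (i : ℤ) : ℕ :=
  if -1 ≤ i then Module.finrank k (ReducedHomology k P (i + 1).toNat) else 0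

/-- The dimension of the order complex of a finite poset: the largest number of elements of a
chain, minus one. The empty poset has dimension `-1`. -/
def orderComplexDim : ℤ :=
  ((sSup {n : ℕ | Nonempty (PosetChain P n)} : ℕ) : ℤ) - 1

/-- A poset is graded if it is bounded and pure (all the maximal chains have the same length). -/
structure IsGradedPoset : Prop where
  exists_bot : ∃ a : P, IsBot a
  exists_top : ∃ b : P, IsTop b
  pure : ∀ s t : Set P, IsMaxChain (· ≤ ·) s → IsMaxChain (· ≤ ·) t → s.encard = t.encard

/-- A (finite) graded poset is Cohen–Macaulay over `k` if the reduced homology of every open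
interval vanishes below the dimension of the order complex of that interval. -/
structure IsCohenMacaulayPoset : Prop extends IsGradedPoset P where
  betti_eq_zero : ∀ x y : P, x < y → ∀ i : ℤ,
    i < orderComplexDim (Set.Ioo x y) → reducedBetti k (Set.Ioo x y) i = 0

end OrderComplex

/-! ### Boolean and group-complemented intervals -/

/-- `L` is a Boolean lattice of rank `n`: it is isomorphic to the lattice of subsets of a set
with `n` elements. -/
def IsBooleanOfRank (L : Type*) [LE L] (n : ℕ) : Prop :=
  Nonempty (L ≃o Finset (Fin n))

section Groups

variable {G : Type*} [Group G]

/-- `K * K' = G` whenever `K` and `K'` are lattice complements of each other in `[H, G]`. (In a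
Boolean interval every `K` has exactly one complement.) -/
def IsGroupComplemented (H : Subgroup G) : Prop :=
  ∀ K K' : Subgroup G, H ≤ K → H ≤ K' → K ⊓ K' = H → K ⊔ K' = ⊤ →
    (K : Set G) * (K' : Set G) = Set.univ

/-- The coset poset `C(H, G)`: all right cosets `Kg` with `H ≤ K < G`, ordered by inclusion. -/
def cosetPoset (H : Subgroup G) : Set (Set G) :=
  {s | ∃ K : Subgroup G, H ≤ K ∧ K < ⊤ ∧ ∃ g : G, s = MulOpposite.op g • (K : Set G)}

/-- The bounded coset poset `Ĉ(H, G) = C(H, G) ∪ {∅, G}`, ordered by inclusion. -/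
def boundedCosetPoset (H : Subgroup G) : Set (Set G) :=
  cosetPoset H ∪ {∅, Set.univ}

/-- The Euler totient `φ(H, G)`: the number of right cosets `Hg` with `⟨Hg⟩ = G`. -/
def eulerTotient (H : Subgroup G) : ℕ :=
  {s : Set G | (∃ g : G, s = MulOpposite.op g • (H : Set G)) ∧ Subgroup.closure s = ⊤}.ncard

open Classical in
/-- The dual Euler totient `∑ μ(H, K) |G : K|`, over `K ∈ [H, G]`, with `μ` the Möbius function
of the subgroup lattice (equivalently, of the interval `[H, G]`). -/
def dualEulerTotient [Finite G] (H : Subgroup G) : ℤ :=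
  letI : Fintype (Subgroup G) := Fintype.ofFinite _
  letI : LocallyFiniteOrder (Subgroup G) := Fintype.toLocallyFiniteOrder
  ∑ K ∈ Finset.Icc H ⊤, IncidenceAlgebra.mu ℤ H K * (K.index : ℤ)

end Groups

end

/-!
Write `[H, G]` as the lattice of subsets of `ι`, with `K_S` the subgroup attached to `S`, and let
`M i = K_{iᶜ}` be its coatoms. Each `K_S` is the intersection of the `M i` with `i ∉ S`, so a coset
`K_S g` is determined by the cosets `M i g` with `i ∉ S`, that is, by a partial transversal of the
family of coset spaces `G / M i`. Since `K_{i} M i = G`, an element `g` can be moved into any coset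
of `M i` by an element of `K_{i}`, which lies in all the other coatoms; hence every partial
transversal arises (`exists_containingCosets_eq`), and the cosets `K_S g`, ordered by inclusion,
are the partial transversals, ordered by reverse inclusion. In other words `C(H, G)` is dual to the
face poset of the join of the discrete sets `G / M i`.

The open intervals of the bounded coset poset are therefore of two kinds: below a coset `K_S g`
with lower end `∅`, they are again joins of discrete sets (`isSpherical_transversals`); between two
cosets, they are boundaries of simplices (`isSpherical_Ioo`). Both have their reduced homology in
the top degree only, by induction on the number of vertices: deleting a vertex from a simplicial
complex leads to the homology of the deletion and of the link (`IsSpherical.of_vertex`), and the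
Betti number of the join is `∏ (|G : M i| - 1)`.

The homological input is the following fact about the order complex of a poset: if the cycles of
the link of an element `x` bound in the complement of `x`, then Betti numbers add,
`β_m(A) = β_m(A \ {x}) + β_{m-1}(link x)` (`bettiIn_succ_of_link_bounds`). It rests on the signed
insertion of `x` in the chains of its link, which is a homotopy between the inclusion of the link
and zero (`posetBoundary_insertMap`). In particular elements with a conical link can be added or
removed freely (`bettiIn_eq_of_conical_links`), which is how the order complex of the face poset
is compared with the simplicial complex itself.

Both totients are equal to the same product: `μ(H, K_S) = (-1) ^ |S|` and
`|G : K_S| = ∏_{i ∉ S} |G : M i|` (`dualEulerTotient_eq`), while `⟨Hg⟩ = G` if and only if `g` lies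
in no `M i` (`eulerTotient_eq`). Each factor is positive because `M i ≠ G`.
-/

noncomputable section

/-! ### Inserting an element in a chain -/

section Chains

variable {P : Type*} [PartialOrder P] {n : ℕ}

theorem PosetChain.ext_range {c d : PosetChain P n} (h : Set.range c = Set.range d) : c = d :=
  DFunLike.coe_injective ((StrictMono.range_inj c.strictMono d.strictMono).1 h)

theorem PosetChain.face_apply (c : PosetChain P (n + 1)) (i : Fin (n + 1)) (j : Fin n) :
    c.face i j = c (i.succAbove j) := rfl

theorem PosetChain.range_face (c : PosetChain P (n + 1)) (i : Fin (n + 1)) :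
    Set.range (c.face i) = Set.range c \ {c i} := by
  have h : (c.face i : Fin n → P) = c ∘ i.succAbove := rfl
  rw [h, Set.range_comp, Fin.range_succAbove, Set.compl_eq_univ_sdiff, Set.image_sdiff c.injective,
    Set.image_univ, Set.image_singleton]

/-- The elements of `P` comparable to `x` and different from it: the vertices of the link of `x`
in `Δ(P)`. -/
def comparables (x : P) : Set P := {y | y < x ∨ x < y}

theorem PosetChain.exists_index (x : P) (l : PosetChain P n) :
    ∃ p : Fin (n + 1), ∀ i, l i < x ↔ i.castSucc < p := by
  by_cases hall : ∀ i, l i < x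
  · exact ⟨Fin.last n, fun i => ⟨fun _ => Fin.castSucc_lt_last i, fun _ => hall i⟩⟩
  · have hne : Set.Nonempty {i | ¬ l i < x} := by simpa [Set.Nonempty] using hall
    obtain ⟨i, hi, hmin⟩ := WellFounded.has_min (wellFounded_lt (α := Fin n)) _ hne
    refine ⟨i.castSucc, fun j => ?_⟩
    rw [Fin.castSucc_lt_castSucc_iff]
    refine ⟨fun hj => ?_, fun hj => ?_⟩
    · by_contra hij
      exact hi ((l.monotone (not_lt.1 hij)).trans_lt hj)
    · by_contra hx
      exact hmin j hx hj

/-- The position at which `x` has to be inserted in a chain of elements comparable to `x`. -/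
def PosetChain.index (x : P) (l : PosetChain P n) : Fin (n + 1) :=
  (l.exists_index x).choose

theorem PosetChain.lt_index (x : P) (l : PosetChain P n) (i : Fin n) :
    l i < x ↔ i.castSucc < l.index x :=
  (l.exists_index x).choose_spec i

/-- The chain obtained by inserting `x` in a chain of elements comparable to `x`. -/
def PosetChain.insert (x : P) (l : PosetChain P n) (h : ∀ i, l i ∈ comparables x) :
    PosetChain P (n + 1) :=
  OrderEmbedding.ofStrictMono ((l.index x).insertNth (α := fun _ => P) x l) <| by
    have key := l.lt_index x
    intro a b hab
    rcases Fin.eq_self_or_eq_succAbove (l.index x) a with rfl | ⟨i, rfl⟩ <;>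
      rcases Fin.eq_self_or_eq_succAbove (l.index x) b with hb | ⟨j, rfl⟩
    · exact absurd hab (by rw [hb]; exact lt_irrefl _)
    · rw [Fin.insertNth_apply_same, Fin.insertNth_apply_succAbove]
      rw [Fin.lt_succAbove_iff_le_castSucc] at hab
      exact (h j).resolve_left fun hj => absurd ((key j).1 hj) (not_lt.2 hab)
    · rw [hb, Fin.insertNth_apply_same, Fin.insertNth_apply_succAbove]
      rw [hb, Fin.succAbove_lt_iff_castSucc_lt] at hab
      exact (key i).2 hab
    · rw [Fin.insertNth_apply_succAbove, Fin.insertNth_apply_succAbove]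
      exact l.strictMono ((Fin.strictMono_succAbove _).lt_iff_lt.1 hab)

theorem PosetChain.insert_index (x : P) (l : PosetChain P n) (h : ∀ i, l i ∈ comparables x) :
    l.insert x h (l.index x) = x :=
  Fin.insertNth_apply_same (α := fun _ => P) _ _ _

theorem PosetChain.insert_succAbove (x : P) (l : PosetChain P n) (h : ∀ i, l i ∈ comparables x)
    (i : Fin n) : l.insert x h ((l.index x).succAbove i) = l i :=
  Fin.insertNth_apply_succAbove (α := fun _ => P) _ _ _ _

theorem PosetChain.face_insert_index (x : P) (l : PosetChain P n)
    (h : ∀ i, l i ∈ comparables x) : (l.insert x h).face (l.index x) = l := by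
  ext i
  exact l.insert_succAbove x h i

theorem PosetChain.range_insert (x : P) (l : PosetChain P n) (h : ∀ i, l i ∈ comparables x) :
    Set.range (l.insert x h) = Insert.insert x (Set.range l) := by
  ext y
  simp only [Set.mem_range, Set.mem_insert_iff]
  constructor
  · rintro ⟨i, rfl⟩
    rcases Fin.eq_self_or_eq_succAbove (l.index x) i with rfl | ⟨j, rfl⟩
    · exact Or.inl (l.insert_index x h)
    · exact Or.inr ⟨j, (l.insert_succAbove x h j).symm⟩
  · rintro (rfl | ⟨j, rfl⟩)
    · exact ⟨_, l.insert_index y h⟩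
    · exact ⟨_, l.insert_succAbove x h j⟩

theorem ne_of_mem_comparables {x y : P} (h : y ∈ comparables x) : y ≠ x := by
  rcases h with h | h
  · exact h.ne
  · exact h.ne'

theorem PosetChain.face_insert_succAbove (x : P) (l : PosetChain P (n + 1))
    (h : ∀ i, l i ∈ comparables x) (i : Fin (n + 1)) :
    (l.insert x h).face ((l.index x).succAbove i) =
      (l.face i).insert x
        (show ∀ j, l.face i j ∈ comparables x from fun j => h (i.succAbove j)) := by
  apply PosetChain.ext_range
  rw [PosetChain.range_face, PosetChain.range_insert, PosetChain.range_insert,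
    PosetChain.range_face, PosetChain.insert_succAbove,
    Set.insert_sdiff_of_notMem]
  exact fun hx => ne_of_mem_comparables (h i) (Set.mem_singleton_iff.1 hx).symm

/-- A chain through `x` arises by inserting `x` in a chain of the link of `x`. -/
theorem PosetChain.exists_eq_insert (c : PosetChain P (n + 1)) (i : Fin (n + 1)) :
    ∃ h : ∀ j, c.face i j ∈ comparables (c i), c = (c.face i).insert (c i) h := by
  have h : ∀ j, c.face i j ∈ comparables (c i) := fun j => by
    rw [PosetChain.face_apply]
    rcases lt_or_gt_of_ne (Fin.succAbove_ne i j) with hj | hj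
    · exact Or.inl (c.strictMono hj)
    · exact Or.inr (c.strictMono hj)
  refine ⟨h, PosetChain.ext_range ?_⟩
  rw [PosetChain.range_insert, PosetChain.range_face, Set.insert_sdiff_singleton,
    Set.insert_eq_of_mem (Set.mem_range_self i)]

end Chains

/-! ### The insertion homotopy -/

section ChainComplex

variable (k : Type*) [Field k] {P : Type*} [PartialOrder P] {n : ℕ}

open Classical in
/-- The sign `(-1) ^ #{i | l i < x}` of the insertion of `x` in the chain `l`. -/
def insertSign (x : P) (l : PosetChain P n) : k := ∏ i, if l i < x then -1 else 1

theorem insertSign_mul_self (x : P) (l : PosetChain P n) :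
    insertSign k x l * insertSign k x l = 1 := by
  unfold insertSign
  rw [← Finset.prod_mul_distrib]
  exact Finset.prod_eq_one fun i _ => by split_ifs <;> simp

theorem insertSign_eq (x : P) (l : PosetChain P n) :
    insertSign k x l = (-1) ^ (l.index x : ℕ) := by
  classical
  unfold insertSign
  rw [Finset.prod_ite, Finset.prod_const, Finset.prod_const_one, mul_one]
  congr 1
  simp_rw [l.lt_index x, Fin.lt_def, Fin.val_castSucc, Fin.card_filter_val_lt]
  exact min_eq_right (Nat.lt_succ_iff.1 (l.index x).is_lt)

theorem insertSign_face (x : P) (l : PosetChain P (n + 1)) (i : Fin (n + 1)) :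
    insertSign k x l * (-1) ^ ((l.index x).succAbove i : ℕ) =
      -((-1) ^ (i : ℕ) * insertSign k x (l.face i)) := by
  classical
  have h1 : insertSign k x l = (if l i < x then -1 else 1) * insertSign k x (l.face i) := by
    unfold insertSign
    rw [Fin.prod_univ_succAbove _ i]
    rfl
  rw [h1]
  by_cases hi : l i < x
  · rw [if_pos hi, Fin.succAbove_of_castSucc_lt _ _ ((l.lt_index x i).1 hi), Fin.val_castSucc]
    ring
  · rw [if_neg hi, Fin.succAbove_of_le_castSucc _ _
      (not_lt.1 (mt (l.lt_index x i).2 hi)), Fin.val_succ, pow_succ]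
    ring

theorem posetBoundary_single (c : PosetChain P (n + 1)) :
    posetBoundary k P n (Finsupp.single c 1) =
      ∑ i : Fin (n + 1), (-1 : k) ^ (i : ℕ) • Finsupp.single (c.face i) 1 := by
  simp [posetBoundary]

open Classical in
/-- The signed insertion of `x`: it sends a chain `l` of the link of `x` to `± (l ∪ {x})`, and the
other chains to `0`. -/
def insertMap (x : P) (n : ℕ) : ChainSpace k P n →ₗ[k] ChainSpace k P (n + 1) :=
  Finsupp.linearCombination k fun l : PosetChain P n =>
    if h : ∀ i, l i ∈ comparables x then insertSign k x l • Finsupp.single (l.insert x h) 1 else 0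

theorem insertMap_single (x : P) (l : PosetChain P n) (h : ∀ i, l i ∈ comparables x) :
    insertMap k x n (Finsupp.single l 1) =
      insertSign k x l • Finsupp.single (l.insert x h) 1 := by
  simp [insertMap, h]

/-- The composition of the boundary with `insertMap`, understood as `0` in degree `-1`. -/
def insertBoundary (x : P) : (n : ℕ) → ChainSpace k P n →ₗ[k] ChainSpace k P n
  | 0 => 0
  | n + 1 => insertMap k x n ∘ₗ posetBoundary k P n

/-- The chains of `Δ(A)`, for a subset `A` of `P`. -/
def chainsIn (A : Set P) (n : ℕ) : Submodule k (ChainSpace k P n) :=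
  Finsupp.supported k k {c : PosetChain P n | ∀ i, c i ∈ A}

variable {k}

theorem single_mem_chainsIn {A : Set P} {c : PosetChain P n} (h : ∀ i, c i ∈ A) (a : k) :
    Finsupp.single c a ∈ chainsIn k A n :=
  Finsupp.single_mem_supported k a h

theorem chainsIn_mono {A B : Set P} (h : A ⊆ B) : chainsIn k A n ≤ chainsIn k B n :=
  Finsupp.supported_mono fun _ hc i => h (hc i)

theorem chainsIn_zero (A : Set P) : chainsIn k A 0 = ⊤ := by
  rw [eq_top_iff]
  intro f _ c _ i
  exact i.elim0

/-- To show that a linear condition holds on the chains of `Δ(A)` it is enough to check it on the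
faces. -/
theorem chainsIn_le {A : Set P} {X : Submodule k (ChainSpace k P n)}
    (h : ∀ c : PosetChain P n, (∀ i, c i ∈ A) → Finsupp.single c 1 ∈ X) : chainsIn k A n ≤ X := by
  rw [chainsIn, Finsupp.supported_eq_span_single, Submodule.span_le]
  rintro _ ⟨c, hc, rfl⟩
  exact h c hc

theorem posetBoundary_mem_chainsIn {A : Set P} {f : ChainSpace k P (n + 1)}
    (hf : f ∈ chainsIn k A (n + 1)) : posetBoundary k P n f ∈ chainsIn k A n := by
  suffices chainsIn k A (n + 1) ≤ (chainsIn k A n).comap (posetBoundary k P n) from this hf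
  refine chainsIn_le fun c hc => ?_
  rw [Submodule.mem_comap, posetBoundary_single]
  exact Submodule.sum_mem _ fun i _ => Submodule.smul_mem _ _
    (single_mem_chainsIn (fun j => hc (i.succAbove j)) 1)

theorem insertMap_mem_chainsIn {A : Set P} {x : P} (hx : x ∈ A) {f : ChainSpace k P n}
    (hf : f ∈ chainsIn k (A ∩ comparables x) n) : insertMap k x n f ∈ chainsIn k A (n + 1) := by
  suffices chainsIn k (A ∩ comparables x) n ≤ (chainsIn k A (n + 1)).comap (insertMap k x n) from
    this hf
  refine chainsIn_le fun c hc => ?_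
  rw [Submodule.mem_comap, insertMap_single k x c fun i => (hc i).2]
  refine Submodule.smul_mem _ _ (single_mem_chainsIn (fun j => ?_) 1)
  have : c.insert x (fun i => (hc i).2) j ∈ Set.range (c.insert x fun i => (hc i).2) :=
    Set.mem_range_self j
  rw [PosetChain.range_insert] at this
  rcases this with h | ⟨i, h⟩
  · rw [h]; exact hx
  · rw [← h]; exact (hc i).1

/-- On the link of `x`, inserting `x` is a contracting homotopy up to the inclusion of the link. -/
theorem posetBoundary_insertMap {x : P} {f : ChainSpace k P n}
    (hf : f ∈ chainsIn k (comparables x) n) :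
    posetBoundary k P n (insertMap k x n f) = f - insertBoundary k x n f := by
  suffices chainsIn k (comparables x) n ≤ LinearMap.eqLocus
      (posetBoundary k P n ∘ₗ insertMap k x n) (LinearMap.id - insertBoundary k x n) from this hf
  refine chainsIn_le fun l hl => ?_
  rw [LinearMap.mem_eqLocus, LinearMap.comp_apply, insertMap_single k x l hl, map_smul,
    posetBoundary_single, Fin.sum_univ_succAbove _ (l.index x), PosetChain.face_insert_index,
    smul_add, smul_smul, ← insertSign_eq, insertSign_mul_self, one_smul, LinearMap.sub_apply,
    LinearMap.id_apply, sub_eq_add_neg]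
  congr 1
  rcases n with _ | n
  · simp [insertBoundary]
  · rw [insertBoundary, LinearMap.comp_apply, posetBoundary_single, map_sum, Finset.smul_sum,
      ← Finset.sum_neg_distrib]
    refine Finset.sum_congr rfl fun i _ => ?_
    rw [smul_smul, insertSign_face k x l i, map_smul,
      insertMap_single k x (l.face i) (fun j => hl (i.succAbove j)), smul_smul,
      PosetChain.face_insert_succAbove, neg_smul]

theorem insertSign_smul_insertMap (x : P) (l : PosetChain P n) (h : ∀ i, l i ∈ comparables x) :
    insertSign k x l • insertMap k x n (Finsupp.single l 1) =
      Finsupp.single (l.insert x h) 1 := by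
  rw [insertMap_single k x l h, smul_smul, insertSign_mul_self, one_smul]

theorem posetBoundary_posetBoundary (f : ChainSpace k P (n + 2)) :
    posetBoundary k P n (posetBoundary k P (n + 1) f) = 0 := by
  suffices ∀ c : PosetChain P (n + 2),
      posetBoundary k P n (posetBoundary k P (n + 1) (Finsupp.single c 1)) = 0 from
    LinearMap.congr_fun (f := posetBoundary k P n ∘ₗ posetBoundary k P (n + 1)) (g := 0)
      (Finsupp.lhom_ext' fun c => LinearMap.ext_ring (this c)) f
  clear f
  -- Every chain is obtained from a shorter one by inserting its least element, so the contracting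
  -- homotopy formula reduces the claim to the previous degree.
  have step : ∀ {m : ℕ} (c : PosetChain P (m + 2)),
      (∀ l : PosetChain P (m + 1), insertBoundary k (c 0) m
        (posetBoundary k P m (Finsupp.single l 1)) = 0) →
      posetBoundary k P m (posetBoundary k P (m + 1) (Finsupp.single c 1)) = 0 := by
    intro m c hc
    obtain ⟨h, hcl⟩ := c.exists_eq_insert 0
    have hl := single_mem_chainsIn h (1 : k)
    rw [hcl, ← insertSign_smul_insertMap (c 0) (c.face 0) h, map_smul, map_smul,
      posetBoundary_insertMap hl, insertBoundary, LinearMap.comp_apply, map_sub,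
      posetBoundary_insertMap (posetBoundary_mem_chainsIn hl), hc, sub_zero, sub_self, smul_zero]
  induction n with
  | zero => exact fun c => step c fun l => rfl
  | succ n ih =>
    exact fun c => step c fun l => (congrArg (insertMap k (c 0) n) (ih l)).trans (map_zero _)

theorem posetBoundary_mem_posetCycles (f : ChainSpace k P (n + 1)) :
    posetBoundary k P n f ∈ posetCycles k P n := by
  cases n with
  | zero => exact Submodule.mem_top
  | succ n => exact LinearMap.mem_ker.2 (posetBoundary_posetBoundary f)

end ChainComplex

/-! ### Splitting chains at an element -/

section Decomposition

variable (k : Type*) [Field k] {P : Type*} [PartialOrder P] {n : ℕ}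

open Classical in
/-- The signed removal of `x`: a left inverse of `insertMap`, vanishing on the chains which do not
contain `x`. -/
def removeMap (x : P) (n : ℕ) : ChainSpace k P (n + 1) →ₗ[k] ChainSpace k P n :=
  Finsupp.linearCombination k fun c : PosetChain P (n + 1) =>
    if h : ∃ i, c i = x then
      insertSign k x (c.face h.choose) • Finsupp.single (c.face h.choose) 1 else 0

variable {k} {x : P} {A : Set P}

theorem removeMap_eq_zero (hx : x ∉ A) {f : ChainSpace k P (n + 1)}
    (hf : f ∈ chainsIn k A (n + 1)) : removeMap k x n f = 0 := by
  suffices chainsIn k A (n + 1) ≤ LinearMap.ker (removeMap k x n) from this hf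
  refine chainsIn_le fun c hc => ?_
  have h : ¬ ∃ i, c i = x := fun ⟨i, hi⟩ => hx (hi ▸ hc i)
  simp [removeMap, h]

theorem removeMap_insertMap {f : ChainSpace k P n} (hf : f ∈ chainsIn k (comparables x) n) :
    removeMap k x n (insertMap k x n f) = f := by
  suffices chainsIn k (comparables x) n ≤ LinearMap.eqLocus
      (removeMap k x n ∘ₗ insertMap k x n) LinearMap.id from this hf
  refine chainsIn_le fun l hl => ?_
  have h : ∃ i, l.insert x hl i = x := ⟨_, l.insert_index x hl⟩
  have hi : h.choose = l.index x :=
    (l.insert x hl).injective (h.choose_spec.trans (l.insert_index x hl).symm)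
  rw [LinearMap.mem_eqLocus, LinearMap.comp_apply, insertMap_single k x l hl, map_smul, removeMap,
    Finsupp.linearCombination_single, dif_pos h, hi, PosetChain.face_insert_index, one_smul,
    smul_smul, insertSign_mul_self, one_smul, LinearMap.id_apply]

/-- The chains of `Δ(A)` split into those of the deletion of `x` and the insertions of `x` in those
of the link of `x`. -/
theorem exists_eq_add_insertMap (x : P) {f : ChainSpace k P (n + 1)}
    (hf : f ∈ chainsIn k A (n + 1)) :
    ∃ d ∈ chainsIn k (A \ {x}) (n + 1), ∃ l ∈ chainsIn k (A ∩ comparables x) n,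
      d + insertMap k x n l = f := by
  suffices chainsIn k A (n + 1) ≤ chainsIn k (A \ {x}) (n + 1) ⊔
      (chainsIn k (A ∩ comparables x) n).map (insertMap k x n) by
    obtain ⟨d, hd, m, hm, h⟩ := Submodule.mem_sup.1 (this hf)
    obtain ⟨l, hl, rfl⟩ := Submodule.mem_map.1 hm
    exact ⟨d, hd, l, hl, h⟩
  refine chainsIn_le fun c hc => ?_
  by_cases h : ∃ i, c i = x
  · obtain ⟨i, rfl⟩ := h
    obtain ⟨h, hci⟩ := c.exists_eq_insert i
    refine Submodule.mem_sup_right ?_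
    nth_rw 3 [hci]
    rw [← insertSign_smul_insertMap _ _ h]
    have hl : ∀ j, c.face i j ∈ A ∩ comparables (c i) := fun j => ⟨hc (i.succAbove j), h j⟩
    exact Submodule.smul_mem _ _ (Submodule.mem_map_of_mem (single_mem_chainsIn hl 1))
  · have hd : ∀ i, c i ∈ A \ {x} := fun i => ⟨hc i, fun hi => h ⟨i, hi⟩⟩
    exact Submodule.mem_sup_left (single_mem_chainsIn hd 1)

theorem self_notMem_comparables (x : P) : x ∉ comparables x := fun h => ne_of_mem_comparables h rfl

theorem removeMap_insertBoundary {f : ChainSpace k P (n + 1)}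
    (hf : f ∈ chainsIn k (comparables x) (n + 1)) :
    removeMap k x n (insertBoundary k x (n + 1) f) = posetBoundary k P n f :=
  removeMap_insertMap (posetBoundary_mem_chainsIn hf)

theorem insertBoundary_eq_zero {f : ChainSpace k P n} (hf : f ∈ posetCycles k P n) :
    insertBoundary k x n f = 0 := by
  cases n with
  | zero => rfl
  | succ n => exact (congrArg (insertMap k x n) (LinearMap.mem_ker.1 hf)).trans (map_zero _)

end Decomposition

/-! ### Betti numbers of subsets of a poset -/

section Betti

variable (k : Type*) [Field k] {P : Type*} [PartialOrder P] {n : ℕ}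

/-- The cycles of `Δ(A)` in degree `n - 1`. -/
def cyclesIn (A : Set P) (n : ℕ) : Submodule k (ChainSpace k P n) :=
  chainsIn k A n ⊓ posetCycles k P n

/-- The boundaries of `Δ(A)` in degree `n - 1`. -/
def boundariesIn (A : Set P) (n : ℕ) : Submodule k (ChainSpace k P n) :=
  (chainsIn k A (n + 1)).map (posetBoundary k P n)

/-- The reduced Betti number in degree `n - 1` of the order complex of a subset `A` of `P`,
computed with chains of `P` supported in `A`. -/
def bettiIn (A : Set P) (n : ℕ) : ℕ :=
  Module.finrank k (cyclesIn k A n) - Module.finrank k (boundariesIn k A n)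

variable {k} {A B : Set P} {x : P}

theorem boundariesIn_le_cyclesIn : boundariesIn k A n ≤ cyclesIn k A n := by
  rintro _ ⟨f, hf, rfl⟩
  exact ⟨posetBoundary_mem_chainsIn hf, posetBoundary_mem_posetCycles f⟩

theorem boundariesIn_mono (h : A ⊆ B) : boundariesIn k A n ≤ boundariesIn k B n :=
  Submodule.map_mono (chainsIn_mono h)

theorem cyclesIn_mono (h : A ⊆ B) : cyclesIn k A n ≤ cyclesIn k B n :=
  inf_le_inf_right _ (chainsIn_mono h)

instance [Finite P] (n : ℕ) : FiniteDimensional k (ChainSpace k P n) :=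
  have : Finite (PosetChain P n) := DFunLike.finite _
  inferInstance

theorem bettiIn_eq_zero_of_le (h : cyclesIn k A n ≤ boundariesIn k A n) : bettiIn k A n = 0 := by
  rw [bettiIn, le_antisymm h boundariesIn_le_cyclesIn, Nat.sub_self]

theorem cyclesIn_le_of_bettiIn_eq_zero [Finite P] (h : bettiIn k A n = 0) :
    cyclesIn k A n ≤ boundariesIn k A n :=
  (Submodule.eq_of_le_of_finrank_le boundariesIn_le_cyclesIn (Nat.sub_eq_zero_iff_le.1 h)).ge

/-- The rank–nullity theorem for the restriction of a linear map to a subspace. -/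
theorem finrank_map_add_finrank_inf_ker {V W : Type*} [AddCommGroup V] [Module k V]
    [AddCommGroup W] [Module k W] [FiniteDimensional k V] (X : Submodule k V) (p : V →ₗ[k] W) :
    Module.finrank k (X.map p) + Module.finrank k ↥(X ⊓ LinearMap.ker p) = Module.finrank k X := by
  rw [← LinearMap.finrank_range_add_finrank_ker (p.domRestrict X), LinearMap.range_domRestrict,
    LinearMap.ker_domRestrict, ← Submodule.map_comap_subtype,
    Submodule.finrank_map_subtype_eq]

/-- The order complex of a poset with an element comparable to all the others is a cone, hence
acyclic. -/
theorem bettiIn_eq_zero_of_cone (hx : x ∈ A) (h : A ⊆ insert x (comparables x)) (n : ℕ) :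
    bettiIn k A n = 0 := by
  have hsub : A \ {x} ⊆ A ∩ comparables x := fun y hy => ⟨hy.1, (h hy.1).resolve_left hy.2⟩
  refine bettiIn_eq_zero_of_le fun f ⟨hf, hc⟩ => ?_
  cases n with
  | zero =>
    have hf' : f ∈ chainsIn k (A ∩ comparables x) 0 := by rw [chainsIn_zero]; trivial
    refine ⟨insertMap k x 0 f, insertMap_mem_chainsIn hx hf', ?_⟩
    rw [posetBoundary_insertMap (chainsIn_mono Set.inter_subset_right hf'),
      insertBoundary_eq_zero hc, sub_zero]
  | succ n =>
    obtain ⟨d, hd, l, hl, rfl⟩ := exists_eq_add_insertMap x hf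
    have hd' := chainsIn_mono hsub hd
    have hd'' := chainsIn_mono Set.inter_subset_right hd'
    have hl' := chainsIn_mono Set.inter_subset_right hl
    refine ⟨insertMap k x _ d, insertMap_mem_chainsIn hx hd', ?_⟩
    have hb : posetBoundary k P n d + (l - insertBoundary k x n l) = 0 := by
      rw [← posetBoundary_insertMap hl', ← map_add]
      exact LinearMap.mem_ker.1 hc
    have hl0 : insertBoundary k x n l = 0 := by
      cases n with
      | zero => rfl
      | succ n =>
        have := congrArg (removeMap k x n) hb
        rw [map_add, map_sub, map_zero, removeMap_insertBoundary hl',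
          removeMap_eq_zero (self_notMem_comparables x) hl',
          removeMap_eq_zero (self_notMem_comparables x) (posetBoundary_mem_chainsIn hd''),
          zero_sub, zero_add, neg_eq_zero] at this
        exact insertBoundary_eq_zero (LinearMap.mem_ker.2 this)
    rw [hl0, sub_zero] at hb
    rw [posetBoundary_insertMap hd'', eq_neg_of_add_eq_zero_right hb, map_neg, sub_eq_add_neg]
    rfl

/-- If the cycles of the link of `x` bound in the deletion of `x`, then the long exact sequence
relating the homology of `A`, of the deletion and of the link splits, and Betti numbers add. -/
theorem bettiIn_succ_of_link_bounds [Finite P] (hx : x ∈ A)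
    (h : ∀ m, cyclesIn k (A ∩ comparables x) m ≤ boundariesIn k (A \ {x}) m) (n : ℕ) :
    bettiIn k A (n + 1) = bettiIn k (A \ {x}) (n + 1) + bettiIn k (A ∩ comparables x) n := by
  have hD : x ∉ A \ {x} := fun h => h.2 rfl
  have hDA : A \ {x} ⊆ A := Set.sdiff_subset
  have hLC : A ∩ comparables x ⊆ comparables x := Set.inter_subset_right
  have hxC := self_notMem_comparables x
  have hZ1 : (cyclesIn k A (n + 1)).map (removeMap k x n) =
      cyclesIn k (A ∩ comparables x) n := by
    apply le_antisymm
    · rintro _ ⟨f, ⟨hf, hc⟩, rfl⟩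
      obtain ⟨d, hd, l, hl, rfl⟩ := exists_eq_add_insertMap x hf
      have hl' := chainsIn_mono hLC hl
      rw [map_add, removeMap_eq_zero hD hd, zero_add, removeMap_insertMap hl']
      refine ⟨hl, ?_⟩
      have hb : posetBoundary k P n d + (l - insertBoundary k x n l) = 0 := by
        rw [← posetBoundary_insertMap hl', ← map_add]
        exact LinearMap.mem_ker.1 hc
      cases n with
      | zero => exact Submodule.mem_top
      | succ n =>
        have := congrArg (removeMap k x n) hb
        rw [map_add, map_sub, map_zero, removeMap_insertBoundary hl',
          removeMap_eq_zero hxC hl', removeMap_eq_zero hD (posetBoundary_mem_chainsIn hd),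
          zero_sub, zero_add, neg_eq_zero] at this
        exact LinearMap.mem_ker.2 this
    · intro l hl
      obtain ⟨d, hd, hdl⟩ := h n hl
      have hl' := chainsIn_mono hLC hl.1
      refine ⟨insertMap k x n l - d, ⟨Submodule.sub_mem _ (insertMap_mem_chainsIn hx hl.1)
        (chainsIn_mono hDA hd), LinearMap.mem_ker.2 ?_⟩, ?_⟩
      · rw [map_sub, posetBoundary_insertMap hl', insertBoundary_eq_zero hl.2, hdl, sub_zero,
          sub_self]
      · rw [map_sub, removeMap_insertMap hl', removeMap_eq_zero hD hd, sub_zero]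
  have hZ2 : cyclesIn k A (n + 1) ⊓ LinearMap.ker (removeMap k x n) =
      cyclesIn k (A \ {x}) (n + 1) := by
    apply le_antisymm
    · rintro f ⟨⟨hf, hc⟩, hk⟩
      obtain ⟨d, hd, l, hl, rfl⟩ := exists_eq_add_insertMap x hf
      have hk : removeMap k x n (d + insertMap k x n l) = 0 := hk
      rw [map_add, removeMap_eq_zero hD hd, zero_add,
        removeMap_insertMap (chainsIn_mono hLC hl)] at hk
      subst hk
      rw [map_zero, add_zero] at hc ⊢
      exact ⟨hd, hc⟩
    · exact fun f hf => ⟨cyclesIn_mono hDA hf, removeMap_eq_zero hD hf.1⟩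
  have hB1 : (boundariesIn k A (n + 1)).map (removeMap k x n) =
      boundariesIn k (A ∩ comparables x) n := by
    apply le_antisymm
    · rintro _ ⟨_, ⟨f, hf, rfl⟩, rfl⟩
      obtain ⟨d, hd, l, hl, rfl⟩ := exists_eq_add_insertMap x hf
      have hl' := chainsIn_mono hLC hl
      refine ⟨-l, Submodule.neg_mem _ hl, ?_⟩
      rw [map_add, posetBoundary_insertMap hl', map_add, map_sub,
        removeMap_eq_zero hD (posetBoundary_mem_chainsIn hd), removeMap_eq_zero hxC hl',
        removeMap_insertBoundary hl', zero_add, zero_sub, map_neg]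
    · rintro _ ⟨l, hl, rfl⟩
      have hl' := chainsIn_mono hLC hl
      refine ⟨_, ⟨insertMap k x _ (-l), insertMap_mem_chainsIn hx (Submodule.neg_mem _ hl), rfl⟩,
        ?_⟩
      rw [map_neg, map_neg, map_neg, posetBoundary_insertMap hl', map_sub,
        removeMap_insertBoundary hl', removeMap_eq_zero hxC hl', zero_sub, neg_neg]
  have hB2 : boundariesIn k A (n + 1) ⊓ LinearMap.ker (removeMap k x n) =
      boundariesIn k (A \ {x}) (n + 1) := by
    apply le_antisymm
    · rintro _ ⟨⟨f, hf, rfl⟩, hk⟩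
      obtain ⟨d, hd, l, hl, rfl⟩ := exists_eq_add_insertMap x hf
      have hl' := chainsIn_mono hLC hl
      have hk : removeMap k x n (posetBoundary k P (n + 1) (d + insertMap k x (n + 1) l)) = 0 := hk
      rw [map_add, posetBoundary_insertMap hl', map_add, map_sub,
        removeMap_eq_zero hD (posetBoundary_mem_chainsIn hd), removeMap_eq_zero hxC hl',
        removeMap_insertBoundary hl', zero_add, zero_sub, neg_eq_zero] at hk
      have hlc : l ∈ posetCycles k P (n + 1) := LinearMap.mem_ker.2 hk
      rw [map_add, posetBoundary_insertMap hl', insertBoundary_eq_zero hlc, sub_zero]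
      exact Submodule.add_mem _ ⟨d, hd, rfl⟩ (h _ ⟨hl, hlc⟩)
    · refine fun f hf => ⟨boundariesIn_mono hDA hf, ?_⟩
      obtain ⟨d, hd, rfl⟩ := hf
      exact removeMap_eq_zero hD (posetBoundary_mem_chainsIn hd)
  have e1 := finrank_map_add_finrank_inf_ker (cyclesIn k A (n + 1)) (removeMap k x n)
  have e2 := finrank_map_add_finrank_inf_ker (boundariesIn k A (n + 1)) (removeMap k x n)
  rw [hZ1, hZ2] at e1
  rw [hB1, hB2] at e2
  have i1 := Submodule.finrank_mono (boundariesIn_le_cyclesIn (k := k) (A := A \ {x}) (n := n + 1))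
  have i2 := Submodule.finrank_mono
    (boundariesIn_le_cyclesIn (k := k) (A := A ∩ comparables x) (n := n))
  unfold bettiIn
  omega

theorem bettiIn_zero_of_link_bounds
    (h : cyclesIn k (A ∩ comparables x) 0 ≤ boundariesIn k (A \ {x}) 0) :
    bettiIn k A 0 = bettiIn k (A \ {x}) 0 := by
  have hZ : cyclesIn k A 0 = cyclesIn k (A \ {x}) 0 := by
    unfold cyclesIn
    rw [chainsIn_zero, chainsIn_zero]
  have hB : boundariesIn k A 0 = boundariesIn k (A \ {x}) 0 := by
    refine le_antisymm ?_ (boundariesIn_mono Set.sdiff_subset)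
    rintro _ ⟨f, hf, rfl⟩
    obtain ⟨d, hd, l, hl, rfl⟩ := exists_eq_add_insertMap x hf
    have hlc : l ∈ posetCycles k P 0 := Submodule.mem_top
    rw [map_add, posetBoundary_insertMap (chainsIn_mono Set.inter_subset_right hl),
      insertBoundary_eq_zero hlc, sub_zero]
    exact Submodule.add_mem _ ⟨d, hd, rfl⟩ (h ⟨hl, hlc⟩)
  rw [bettiIn, bettiIn, hZ, hB]

theorem bettiIn_empty [Finite P] (n : ℕ) : bettiIn k (∅ : Set P) n = if n = 0 then 1 else 0 := by
  have hC : ∀ m, chainsIn k (∅ : Set P) (m + 1) = ⊥ := fun m =>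
    eq_bot_iff.2 (chainsIn_le fun c hc => (hc 0).elim)
  have hB : ∀ m, boundariesIn k (∅ : Set P) m = ⊥ := fun m => by
    rw [boundariesIn, hC, Submodule.map_bot]
  cases n with
  | zero =>
    have hZ : cyclesIn k (∅ : Set P) 0 = ⊤ := by
      rw [cyclesIn, chainsIn_zero, top_inf_eq]; rfl
    rw [bettiIn, hB, hZ, finrank_bot, finrank_top, if_pos rfl, Nat.sub_zero]
    have : Unique (PosetChain P 0) :=
      ⟨⟨RelEmbedding.ofIsEmpty _ _⟩, fun c => by ext i; exact i.elim0⟩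
    rw [Module.finrank_finsupp_self, Fintype.card_unique]
  | succ n => rw [bettiIn, cyclesIn, hC, bot_inf_eq, finrank_bot, Nat.zero_sub, if_neg (by simp)]

end Betti

/-! ### Invariance under order embeddings -/

section Transfer

variable {k : Type*} [Field k] {Q P : Type*} [PartialOrder Q] [PartialOrder P]

theorem finrank_submoduleOf_quotient {V : Type*} [AddCommGroup V] [Module k V]
    [FiniteDimensional k V] {B Z : Submodule k V} (h : B ≤ Z) :
    Module.finrank k (Z ⧸ B.submoduleOf Z) = Module.finrank k Z - Module.finrank k B := by
  rw [Submodule.finrank_quotient, (Submodule.submoduleOfEquivOfLe h).finrank_eq]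

/-- The reduced homology of `Δ(Q)` can be computed in a poset in which `Q` is embedded. -/
theorem finrank_reducedHomology [Finite P] (e : Q ↪o P) (n : ℕ) :
    Module.finrank k (ReducedHomology k Q n) = bettiIn k (Set.range e) n := by
  have : Finite Q := Finite.of_injective e e.injective
  -- the injective chain map induced by `e`
  let F : (m : ℕ) → ChainSpace k Q m →ₗ[k] ChainSpace k P m := fun m =>
    Finsupp.lmapDomain k k fun c : PosetChain Q m => c.trans e
  have hinj : ∀ m, Function.Injective (F m) := fun m =>
    Finsupp.mapDomain_injective fun c d h => by
      ext i
      exact e.injective (DFunLike.congr_fun h i)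
  have hF : ∀ m c, F m (Finsupp.single c 1) = Finsupp.single (c.trans e) 1 := fun m c =>
    Finsupp.mapDomain_single
  have hcomm : ∀ m f, posetBoundary k P m (F (m + 1) f) = F m (posetBoundary k Q m f) := by
    intro m f
    refine LinearMap.congr_fun (f := posetBoundary k P m ∘ₗ F (m + 1))
      (g := F m ∘ₗ posetBoundary k Q m) (Finsupp.lhom_ext' fun c => LinearMap.ext_ring ?_) f
    change posetBoundary k P m (F (m + 1) (Finsupp.single c 1)) =
      F m (posetBoundary k Q m (Finsupp.single c 1))
    rw [hF, posetBoundary_single, posetBoundary_single, map_sum]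
    refine Finset.sum_congr rfl fun i _ => ?_
    rw [map_smul, hF]
    rfl
  have hchains : ∀ m, (⊤ : Submodule k (ChainSpace k Q m)).map (F m) =
      chainsIn k (Set.range e) m := by
    intro m
    apply le_antisymm
    · rintro _ ⟨f, -, rfl⟩
      induction f using Finsupp.induction_linear with
      | zero => rw [map_zero]; exact Submodule.zero_mem _
      | add f g hf hg => rw [map_add]; exact Submodule.add_mem _ hf hg
      | single c a =>
        rw [← mul_one a, ← smul_eq_mul, ← Finsupp.smul_single, map_smul, hF]
        have hc : ∀ i, c.trans e i ∈ Set.range e := fun i => ⟨c i, rfl⟩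
        exact Submodule.smul_mem _ _ (single_mem_chainsIn hc 1)
    · refine chainsIn_le fun c hc => ?_
      choose g hg using hc
      let d : PosetChain Q m := OrderEmbedding.ofMapLEIff g fun a b => by
        rw [← e.le_iff_le, hg, hg, c.le_iff_le]
      refine ⟨Finsupp.single d 1, trivial, (hF m d).trans ?_⟩
      congr 1
      ext i
      exact hg i
  have hcycles : (posetCycles k Q n).map (F n) = cyclesIn k (Set.range e) n := by
    rw [cyclesIn, ← hchains]
    cases n with
    | zero => exact (inf_top_eq _).symm
    | succ n =>
      ext f
      constructor
      · rintro ⟨g, hg, rfl⟩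
        refine ⟨⟨g, trivial, rfl⟩, LinearMap.mem_ker.2 ?_⟩
        rw [hcomm, LinearMap.mem_ker.1 hg, map_zero]
      · rintro ⟨⟨g, -, rfl⟩, hg⟩
        refine ⟨g, LinearMap.mem_ker.2 (hinj n ?_), rfl⟩
        rw [← hcomm, map_zero]
        exact LinearMap.mem_ker.1 hg
  have hbound : (LinearMap.range (posetBoundary k Q n)).map (F n) =
      boundariesIn k (Set.range e) n := by
    rw [boundariesIn, ← hchains, LinearMap.range_eq_map, ← Submodule.map_comp, ← Submodule.map_comp]
    congr 1
    exact LinearMap.ext fun f => (hcomm n f).symm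
  have hle : LinearMap.range (posetBoundary k Q n) ≤ posetCycles k Q n := by
    rintro _ ⟨f, rfl⟩
    exact posetBoundary_mem_posetCycles f
  rw [finrank_submoduleOf_quotient hle, bettiIn, ← hcycles, ← hbound,
    (Submodule.equivMapOfInjective (F n) (hinj n) _).finrank_eq,
    (Submodule.equivMapOfInjective (F n) (hinj n) _).finrank_eq]

end Transfer

/-! ### Homology concentrated in one degree -/

section Spherical

variable (k : Type*) [Field k] {P : Type*} [PartialOrder P] {n m b c : ℕ}

/-- The reduced homology of `Δ(A)` is concentrated in degree `m - 1`, where its dimension is `b`. -/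
def IsSpherical (A : Set P) (m b : ℕ) : Prop :=
  ∀ j, bettiIn k A j = if j = m then b else 0

variable {k} {A B : Set P} {x y : P}

theorem isSpherical_empty [Finite P] : IsSpherical k (∅ : Set P) 0 1 := bettiIn_empty

theorem isSpherical_of_bettiIn_eq_zero (h : ∀ j, bettiIn k A j = 0) (m : ℕ) :
    IsSpherical k A m 0 := fun j => by rw [h, ite_self]

/-- The long exact sequence of the deletion and of the link of `x` splits for degree reasons. -/
theorem IsSpherical.of_link [Finite P] (hx : x ∈ A) (hD : IsSpherical k (A \ {x}) (m + 1) b)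
    (hL : IsSpherical k (A ∩ comparables x) m c) : IsSpherical k A (m + 1) (b + c) := by
  -- in each degree, the link or the deletion is acyclic
  have h : ∀ j, cyclesIn k (A ∩ comparables x) j ≤ boundariesIn k (A \ {x}) j := by
    intro j
    have hsub : A ∩ comparables x ⊆ A \ {x} := fun y hy => ⟨hy.1, ne_of_mem_comparables hy.2⟩
    by_cases hj : j = m
    · exact (cyclesIn_mono hsub).trans (cyclesIn_le_of_bettiIn_eq_zero
        ((hD j).trans (if_neg (by omega))))
    · exact (cyclesIn_le_of_bettiIn_eq_zero ((hL j).trans (if_neg hj))).trans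
        (boundariesIn_mono hsub)
  intro j
  cases j with
  | zero => rw [bettiIn_zero_of_link_bounds (h 0), hD]; simp
  | succ j =>
    rw [bettiIn_succ_of_link_bounds hx h, hD, hL]
    by_cases hj : j = m <;> simp [hj]

/-- Deleting an element whose link is a cone does not change the homology. -/
theorem bettiIn_sdiff_singleton [Finite P] (hx : x ∈ A) (hy : y ∈ A) (hxy : y ∈ comparables x)
    (h : ∀ z ∈ A, z ∈ comparables x → z = y ∨ z ∈ comparables y) (n : ℕ) :
    bettiIn k A n = bettiIn k (A \ {x}) n := by
  have hL : ∀ j, bettiIn k (A ∩ comparables x) j = 0 :=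
    bettiIn_eq_zero_of_cone ⟨hy, hxy⟩ fun z hz => h z hz.1 hz.2
  have hsub : A ∩ comparables x ⊆ A \ {x} := fun y hy => ⟨hy.1, ne_of_mem_comparables hy.2⟩
  have hb : ∀ j, cyclesIn k (A ∩ comparables x) j ≤ boundariesIn k (A \ {x}) j := fun j =>
    (cyclesIn_le_of_bettiIn_eq_zero (hL j)).trans (boundariesIn_mono hsub)
  cases n with
  | zero => exact bettiIn_zero_of_link_bounds (hb 0)
  | succ n => rw [bettiIn_succ_of_link_bounds hx hb, hL, add_zero]

/-- If `B` is obtained from `A` by successively adding elements, by increasing values of `r`, and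
each of them has a conical link at the time it is added, then `A` and `B` have the same homology. -/
theorem bettiIn_eq_of_conical_links [Finite P] (r : P → ℤ) (hAB : A ⊆ B)
    (h : ∀ x ∈ B, x ∉ A → ∃ y ∈ A, y ∈ comparables x ∧ ∀ z ∈ B, z ∈ comparables x →
      (z ∈ A ∨ r z ≤ r x) → z = y ∨ z ∈ comparables y) (n : ℕ) :
    bettiIn k B n = bettiIn k A n := by
  induction hN : (B \ A).ncard generalizing B with
  | zero =>
    rw [Set.ncard_eq_zero, Set.sdiff_eq_empty] at hN
    rw [hN.antisymm hAB]
  | succ N ih =>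
    have hne : (B \ A).Nonempty := Set.nonempty_of_ncard_ne_zero (by omega)
    obtain ⟨x, ⟨hxB, hxA⟩, hmax⟩ := Set.exists_max_image (B \ A) r (Set.toFinite _) hne
    obtain ⟨y, hyA, hyx, hcone⟩ := h x hxB hxA
    rw [bettiIn_sdiff_singleton hxB (hAB hyA) hyx fun z hz hzx => hcone z hz hzx <|
      or_iff_not_imp_left.2 fun hzA => hmax z ⟨hz, hzA⟩]
    have hAB' : A ⊆ B \ {x} := Set.subset_sdiff_singleton hAB hxA
    refine ih hAB' (fun z hz hzA => ?_) ?_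
    · obtain ⟨w, hw, hwz, hcone⟩ := h z hz.1 hzA
      exact ⟨w, hw, hwz, fun u hu => hcone u hu.1⟩
    · have hx : x ∈ B \ A := ⟨hxB, hxA⟩
      rw [Set.sdiff_sdiff_comm, Set.ncard_sdiff_singleton_of_mem hx, hN, Nat.add_sub_cancel]

end Spherical

/-! ### Simplicial complexes: boundaries of simplices and joins of discrete sets -/

section Complexes

open OrderDual

variable {k : Type*} [Field k] {V : Type*} {m b c : ℕ}

/-- A family of finite sets, ordered by reverse inclusion, as the cosets `Kg` ordered by inclusion
correspond to partial transversals ordered by reverse inclusion. -/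
def reverseFamily (A : Set (Finset V)) : Set (Finset V)ᵒᵈ := ofDual ⁻¹' A

theorem mem_comparables_ofDual {σ τ : (Finset V)ᵒᵈ} :
    σ ∈ comparables τ ↔ ofDual σ ⊂ ofDual τ ∨ ofDual τ ⊂ ofDual σ :=
  or_comm

variable [Finite V] [DecidableEq V] {A : Set (Finset V)} {σ₀ : Finset V} {v : V}

/-- A family of finite sets strictly containing `σ₀`, closed under taking smaller such sets, is
the face poset of a simplicial complex. Its homology is obtained from those of the deletion and of
the link of a vertex `v`. -/
theorem IsSpherical.of_vertex (hv : v ∉ σ₀) (hσ : ∀ σ ∈ A, σ₀ ⊂ σ)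
    (hdown : ∀ σ ∈ A, ∀ τ, σ₀ ⊂ τ → τ ⊆ σ → τ ∈ A) (hvA : insert v σ₀ ∈ A)
    (hdel : IsSpherical k (reverseFamily {σ | σ ∈ A ∧ v ∉ σ}) (m + 1) b)
    (hlink : IsSpherical k (reverseFamily {σ | σ ∈ A ∧ insert v σ₀ ⊂ σ}) m c) :
    IsSpherical k (reverseFamily A) (m + 1) (b + c) := by
  have hvA' : toDual (insert v σ₀) ∈ reverseFamily A := hvA
  refine IsSpherical.of_link hvA' ?_ ?_
  · intro j
    rw [← hdel j]
    -- the faces `τ` containing `v` are added by decreasing size, and `τ.erase v` is then a cone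
    -- point of the link of `τ`
    have hsub : reverseFamily {σ | σ ∈ A ∧ v ∉ σ} ⊆
        reverseFamily A \ {toDual (insert v σ₀)} := fun σ hσ' => ⟨hσ'.1, fun h => by
      have h : ofDual σ = insert v σ₀ := h
      exact hσ'.2 (h ▸ Finset.mem_insert_self v σ₀)⟩
    refine bettiIn_eq_of_conical_links (fun σ => -(ofDual σ).card) hsub (fun τ hτ hτv => ?_) j
    · have hτA : ofDual τ ∈ A := hτ.1
      have hvτ : v ∈ ofDual τ := by
        by_contra h
        exact hτv ⟨hτA, h⟩
      have hsub : σ₀ ⊆ (ofDual τ).erase v := Finset.subset_erase.2 ⟨(hσ _ hτA).1, hv⟩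
      have hss : σ₀ ⊂ (ofDual τ).erase v := hsub.ssubset_of_ne fun h => hτ.2 <| by
        change ofDual τ = insert v σ₀
        rw [h, Finset.insert_erase hvτ]
      have hlt := Finset.erase_ssubset hvτ
      refine ⟨toDual ((ofDual τ).erase v), ⟨hdown _ hτA _ hss hlt.1, Finset.notMem_erase v _⟩,
        mem_comparables_ofDual.2 (Or.inl hlt), fun z hz hzτ hr => ?_⟩
      rcases mem_comparables_ofDual.1 hzτ with h | h
      · have hvz : v ∉ ofDual z := by
          rcases hr with hr | hr
          · exact hr.2
          · have := Finset.card_lt_card h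
            omega
        rcases (Finset.subset_erase.2 ⟨h.1, hvz⟩).eq_or_ssubset with h | h
        · exact Or.inl h
        · exact Or.inr (mem_comparables_ofDual.2 (Or.inl h))
      · exact Or.inr (mem_comparables_ofDual.2 (Or.inr (hlt.trans h)))
  · convert hlink using 1
    ext τ
    constructor
    · rintro ⟨hτ, h⟩
      refine ⟨hτ, (mem_comparables_ofDual.1 h).resolve_left fun h => ?_⟩
      have h1 : σ₀.card < (ofDual τ).card := Finset.card_lt_card (hσ _ hτ)
      have h2 : (ofDual τ).card < (insert v σ₀).card := Finset.card_lt_card h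
      rw [Finset.card_insert_of_notMem hv] at h2
      omega
    · rintro ⟨hτ, h⟩
      exact ⟨hτ, mem_comparables_ofDual.2 (Or.inr h)⟩

/-- A simplicial complex is acyclic if `v` can be added to each of its faces. -/
theorem bettiIn_eq_zero_of_cone_vertex (hσ : ∀ σ ∈ A, σ₀ ⊂ σ)
    (hcone : ∀ σ ∈ A, insert v σ ∈ A) (hvA : insert v σ₀ ∈ A) (n : ℕ) :
    bettiIn k (reverseFamily A) n = 0 := by
  -- the faces `τ` not containing `v` are added by increasing size to those containing `v`, and
  -- `insert v τ` is then a cone point of the link of `τ`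
  have hvA' : toDual (insert v σ₀) ∈ reverseFamily {σ | σ ∈ A ∧ v ∈ σ} :=
    ⟨hvA, Finset.mem_insert_self v σ₀⟩
  rw [← bettiIn_eq_zero_of_cone (k := k) hvA' (fun σ hσ' => ?_) n]
  · refine bettiIn_eq_of_conical_links (fun σ => (ofDual σ).card) (fun σ hσ => hσ.1)
      (fun τ hτ hτv => ?_) n
    have hτA : ofDual τ ∈ A := hτ
    have hvτ : v ∉ ofDual τ := fun h => hτv ⟨hτA, h⟩
    have hlt := Finset.ssubset_insert hvτ
    refine ⟨toDual (insert v (ofDual τ)), ⟨hcone _ hτA, Finset.mem_insert_self _ _⟩,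
        mem_comparables_ofDual.2 (Or.inr hlt), fun z hz hzτ hr => ?_⟩
    rcases mem_comparables_ofDual.1 hzτ with h | h
    · exact Or.inr (mem_comparables_ofDual.2 (Or.inl (h.trans hlt)))
    · have hvz : v ∈ ofDual z := by
        rcases hr with hr | hr
        · exact hr.2
        · have := Finset.card_lt_card h
          omega
      rcases (Finset.insert_subset hvz h.1).eq_or_ssubset with h | h
      · exact Or.inl h.symm
      · exact Or.inr (mem_comparables_ofDual.2 (Or.inr h))
  · rcases (Finset.insert_subset hσ'.2 (hσ _ hσ'.1).1).eq_or_ssubset with h | h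
    · exact Or.inl h.symm
    · exact Or.inr (mem_comparables_ofDual.2 (Or.inr h))

/-- The boundary of a simplex is a homology sphere. -/
theorem isSpherical_Ioo (m : ℕ) {σ τ : Finset V} (hστ : σ ⊆ τ) (hcard : τ.card = σ.card + m + 1) :
    IsSpherical k (reverseFamily (Set.Ioo σ τ)) m 1 := by
  induction m generalizing σ with
  | zero =>
    have : Set.Ioo σ τ = ∅ := Set.eq_empty_iff_forall_notMem.2 fun ρ hρ => by
      have h1 := Finset.card_lt_card hρ.1
      have h2 := Finset.card_lt_card hρ.2
      omega
    rw [this]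
    exact isSpherical_empty
  | succ m ih =>
    obtain ⟨v, hv⟩ : (τ \ σ).Nonempty := by
      rw [← Finset.card_pos, Finset.card_sdiff_of_subset hστ]; omega
    rw [Finset.mem_sdiff] at hv
    have hvτ := Finset.insert_subset hv.1 hστ
    have hvcard := Finset.card_insert_of_notMem hv.2
    have hlink := ih hvτ (by omega)
    obtain ⟨u, hu⟩ : (τ \ insert v σ).Nonempty := by
      rw [← Finset.card_pos, Finset.card_sdiff_of_subset hvτ]; omega
    rw [Finset.mem_sdiff, Finset.mem_insert, not_or] at hu
    rw [← zero_add 1]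
    refine IsSpherical.of_vertex hv.2 (fun ρ hρ => hρ.1)
      (fun ρ hρ π h1 h2 => ⟨h1, lt_of_le_of_lt h2 hρ.2⟩)
      ⟨Finset.ssubset_insert hv.2, hvτ.ssubset_of_ne fun h => ?_⟩
      (isSpherical_of_bettiIn_eq_zero ?_ _) ?_
    · rw [← h] at hcard; omega
    · refine bettiIn_eq_zero_of_cone_vertex (v := u) (fun ρ hρ => hρ.1.1) (fun ρ hρ => ?_) ?_
      · have hvu : v ∉ insert u ρ := by
          rw [Finset.mem_insert, not_or]
          exact ⟨Ne.symm hu.2.1, hρ.2⟩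
        refine ⟨⟨lt_of_lt_of_le hρ.1.1 (Finset.subset_insert _ _),
          (Finset.insert_subset hu.1 hρ.1.2.1).ssubset_of_ne fun h => ?_⟩, hvu⟩
        exact hvu (h ▸ hv.1)
      · have hvu : v ∉ insert u σ := by
          rw [Finset.mem_insert, not_or]
          exact ⟨Ne.symm hu.2.1, hv.2⟩
        refine ⟨⟨Finset.ssubset_insert hu.2.2,
          (Finset.insert_subset hu.1 hστ).ssubset_of_ne fun h => ?_⟩, hvu⟩
        exact hvu (h ▸ hv.1)
    · convert hlink using 2
      ext ρ
      exact ⟨fun h => ⟨h.2, h.1.2⟩, fun h => ⟨⟨(Finset.ssubset_insert hv.2).trans h.1, h.2⟩, h.1⟩⟩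

variable {ι : Type*} [DecidableEq ι]

/-- The partial transversals strictly containing `σ₀` and with all their further elements in `W`.
A partial transversal of the colour classes is a set on which the colouring `col` is injective. -/
def transversals (col : V → ι) (σ₀ W : Finset V) : Set (Finset V) :=
  {σ | σ₀ ⊂ σ ∧ σ ⊆ σ₀ ∪ W ∧ Set.InjOn col σ}

/-- The complex of the partial transversals of a family of finite sets is the join of these sets,
seen as discrete spaces. -/
theorem isSpherical_transversals (col : V → ι) (W : Finset V) {σ₀ : Finset V}
    (hinj : Set.InjOn col σ₀) (hcol : ∀ w ∈ W, ∀ s ∈ σ₀, col w ≠ col s) :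
    IsSpherical k (reverseFamily (transversals col σ₀ W)) (W.image col).card
      (∏ i ∈ W.image col, ((W.filter fun w => col w = i).card - 1)) := by
  induction hN : W.card using Nat.strong_induction_on generalizing W σ₀ with
  | _ N ih =>
  subst hN
  rcases W.eq_empty_or_nonempty with rfl | ⟨w, hw⟩
  · have : transversals col σ₀ ∅ = ∅ := Set.eq_empty_iff_forall_notMem.2 fun σ hσ =>
      hσ.1.not_subset (by simpa using hσ.2.1)
    rw [this]
    exact isSpherical_empty
  have hwσ : w ∉ σ₀ := fun h => hcol w hw w h rfl
  -- the elements of other colours than `w`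
  set R := W.filter fun u => col u ≠ col w with hR
  have hRW : R.card < W.card := Finset.card_lt_card <| Finset.filter_ssubset.2 ⟨w, hw, by simp⟩
  have hinj' : Set.InjOn col (insert w σ₀ : Finset V) := by
    rw [Finset.coe_insert, Set.injOn_insert (by simpa using hwσ)]
    refine ⟨hinj, ?_⟩
    rintro ⟨s, hs, h⟩
    exact hcol w hw s hs h.symm
  have hcol' : ∀ u ∈ R, ∀ s ∈ insert w σ₀, col u ≠ col s := by
    intro u hu s hs
    rw [hR, Finset.mem_filter] at hu
    rcases Finset.mem_insert.1 hs with rfl | hs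
    · exact hu.2
    · exact hcol u hu.1 s hs
  have hlink := ih _ hRW R hinj' hcol' rfl
  have hRimage : R.image col = (W.image col).erase (col w) := by
    ext i
    simp only [hR, Finset.mem_image, Finset.mem_filter, Finset.mem_erase]
    constructor
    · rintro ⟨u, ⟨h1, h2⟩, rfl⟩; exact ⟨h2, u, h1, rfl⟩
    · rintro ⟨h2, u, h1, rfl⟩; exact ⟨u, ⟨h1, h2⟩, rfl⟩
  have hwi : col w ∈ W.image col := Finset.mem_image_of_mem col hw
  have hprodR : ∏ i ∈ R.image col, ((R.filter fun u => col u = i).card - 1) =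
      ∏ i ∈ (W.image col).erase (col w), ((W.filter fun u => col u = i).card - 1) := by
    rw [hRimage]
    refine Finset.prod_congr rfl fun i hi => ?_
    congr 2
    rw [hR, Finset.filter_filter]
    refine Finset.filter_congr fun u _ => ⟨fun h => h.2, fun h => ⟨?_, h⟩⟩
    rw [h]
    exact (Finset.mem_erase.1 hi).1
  have hcard : (W.image col).card = (R.image col).card + 1 := by
    rw [hRimage, Finset.card_erase_add_one hwi]
  have hlinkeq : {σ | σ ∈ transversals col σ₀ W ∧ insert w σ₀ ⊂ σ} =
      transversals col (insert w σ₀) R := by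
    ext σ
    constructor
    · rintro ⟨⟨-, h1, h2⟩, h3⟩
      refine ⟨h3, fun u hu => ?_, h2⟩
      rcases Finset.mem_union.1 (h1 hu) with hu' | hu'
      · exact Finset.mem_union_left _ (Finset.mem_insert_of_mem hu')
      · by_cases hc : col u = col w
        · rw [h2 hu (h3.1 (Finset.mem_insert_self _ _)) hc]
          exact Finset.mem_union_left _ (Finset.mem_insert_self _ _)
        · exact Finset.mem_union_right _ (Finset.mem_filter.2 ⟨hu', hc⟩)
    · rintro ⟨h1, h2, h3⟩
      refine ⟨⟨(Finset.ssubset_insert hwσ).trans h1, fun u hu => ?_, h3⟩, h1⟩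
      rcases Finset.mem_union.1 (h2 hu) with hu' | hu'
      · rcases Finset.mem_insert.1 hu' with rfl | hu'
        · exact Finset.mem_union_right _ hw
        · exact Finset.mem_union_left _ hu'
      · exact Finset.mem_union_right _ (Finset.mem_filter.1 hu').1
  have hwmem : insert w σ₀ ∈ transversals col σ₀ W :=
    ⟨Finset.ssubset_insert hwσ, Finset.insert_subset (Finset.mem_union_right _ hw)
      Finset.subset_union_left, hinj'⟩
  rw [hcard, ← Finset.mul_prod_erase _ _ hwi, ← hprodR]
  -- if `w` is alone in its colour class, it is a cone point
  by_cases hw1 : ∃ u ∈ W, u ≠ w ∧ col u = col w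
  · obtain ⟨u, hu, huw, hcu⟩ := hw1
    have hdel := ih _ (Finset.card_erase_lt_of_mem hw) (W.erase w) hinj
      (fun x hx => hcol x (Finset.mem_of_mem_erase hx)) rfl
    have himage : (W.erase w).image col = W.image col := by
      refine (Finset.image_subset_image (Finset.erase_subset _ _)).antisymm fun i hi => ?_
      obtain ⟨x, hx, rfl⟩ := Finset.mem_image.1 hi
      by_cases hxw : x = w
      · rw [hxw, ← hcu]
        exact Finset.mem_image_of_mem _ (Finset.mem_erase.2 ⟨huw, hu⟩)
      · exact Finset.mem_image_of_mem _ (Finset.mem_erase.2 ⟨hxw, hx⟩)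
    have hfw : ((W.erase w).filter fun x => col x = col w).card + 1 =
        (W.filter fun x => col x = col w).card := by
      rw [Finset.filter_erase]
      exact Finset.card_erase_add_one (Finset.mem_filter.2 ⟨hw, rfl⟩)
    have hpos : 0 < ((W.erase w).filter fun x => col x = col w).card :=
      Finset.card_pos.2 ⟨u, Finset.mem_filter.2 ⟨Finset.mem_erase.2 ⟨huw, hu⟩, hcu⟩⟩
    have hprod : ∏ i ∈ (W.image col).erase (col w),
        (((W.erase w).filter fun x => col x = i).card - 1) =
        ∏ i ∈ R.image col, ((R.filter fun u => col u = i).card - 1) := by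
      rw [hprodR]
      refine Finset.prod_congr rfl fun i hi => ?_
      rw [Finset.filter_erase, Finset.erase_eq_of_notMem fun h =>
        (Finset.mem_erase.1 hi).1 (Finset.mem_filter.1 h).2.symm]
    rw [himage, hcard, ← Finset.mul_prod_erase _ _ hwi, hprod] at hdel
    have hsum : ((W.filter fun x => col x = col w).card - 1) *
          ∏ i ∈ R.image col, ((R.filter fun u => col u = i).card - 1) =
        (((W.erase w).filter fun x => col x = col w).card - 1) *
          ∏ i ∈ R.image col, ((R.filter fun u => col u = i).card - 1) +
          ∏ i ∈ R.image col, ((R.filter fun u => col u = i).card - 1) := by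
      rw [← hfw, ← Nat.succ_mul]
      congr 1
      omega
    rw [hsum]
    refine IsSpherical.of_vertex hwσ (fun σ hσ => hσ.1)
      (fun σ hσ τ h1 h2 => ⟨h1, h2.trans hσ.2.1, hσ.2.2.mono (Finset.coe_subset.2 h2)⟩) hwmem ?_ ?_
    · convert hdel using 2
      ext σ
      constructor
      · rintro ⟨⟨h1, h2, h3⟩, h4⟩
        refine ⟨h1, fun x hx => ?_, h3⟩
        rcases Finset.mem_union.1 (h2 hx) with hx' | hx'
        · exact Finset.mem_union_left _ hx'
        · exact Finset.mem_union_right _ (Finset.mem_erase.2 ⟨fun h => h4 (h ▸ hx), hx'⟩)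
      · rintro ⟨h1, h2, h3⟩
        refine ⟨⟨h1, h2.trans (Finset.union_subset_union_right (Finset.erase_subset _ _)), h3⟩,
          fun h => ?_⟩
        rcases Finset.mem_union.1 (h2 h) with h | h
        · exact hwσ h
        · exact Finset.notMem_erase _ _ h
    · rw [hlinkeq]
      exact hlink
  · push Not at hw1
    have hfw : (W.filter fun x => col x = col w) = {w} := by
      ext x
      rw [Finset.mem_filter, Finset.mem_singleton]
      refine ⟨fun h => by_contra fun hx => hw1 x h.1 hx h.2, ?_⟩
      rintro rfl
      exact ⟨hw, rfl⟩
    rw [hfw, Finset.card_singleton, Nat.sub_self, zero_mul]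
    refine isSpherical_of_bettiIn_eq_zero (bettiIn_eq_zero_of_cone_vertex (v := w)
      (fun σ hσ => hσ.1) (fun σ hσ => ?_) hwmem) _
    refine ⟨lt_of_lt_of_le hσ.1 (Finset.subset_insert _ _),
      Finset.insert_subset (Finset.mem_union_right _ hw) hσ.2.1, ?_⟩
    by_cases hws : w ∈ σ
    · rw [Finset.insert_eq_of_mem hws]; exact hσ.2.2
    · rw [Finset.coe_insert, Set.injOn_insert (by simpa using hws)]
      refine ⟨hσ.2.2, ?_⟩
      rintro ⟨s, hs, h⟩
      rcases Finset.mem_union.1 (hσ.2.1 hs) with h' | h'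
      · exact hcol w hw s h' h.symm
      · exact hw1 s h' (fun hsw => hws (hsw ▸ hs)) h

end Complexes

/-! ### Graded posets and dimensions of order complexes -/

section GradedPosets

variable {Q : Type*} [PartialOrder Q]

/-- A bounded poset with a strictly monotone rank function, in which there is an element strictly
between any two comparable elements whose ranks are not consecutive, is graded. -/
theorem isGradedPoset_of_rank (ρ : Q → ℕ) (hρ : StrictMono ρ) {a₀ b₀ : Q} (ha₀ : IsBot a₀)
    (hb₀ : IsTop b₀) (h : ∀ a b, a < b → ρ a + 1 < ρ b → ∃ z, a < z ∧ z < b) :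
    IsGradedPoset Q := by
  -- the rank function maps every maximal chain bijectively to the interval of all ranks
  have key : ∀ s : Set Q, IsMaxChain (· ≤ ·) s →
      Set.InjOn ρ s ∧ ρ '' s = Set.Icc (ρ a₀) (ρ b₀) := by
    intro s hs
    have hlt : ∀ x ∈ s, ∀ y ∈ s, ρ x < ρ y → x < y := fun x hx y hy hxy =>
      ((hs.1.total hx hy).resolve_right fun h => (hρ.monotone h).not_gt hxy).lt_of_ne
        fun h => hxy.ne (congrArg ρ h)
    have hmem : ∀ z, (∀ c ∈ s, z ≤ c ∨ c ≤ z) → z ∈ s := fun z hz => by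
      rw [hs.2 (hs.1.insert fun c hc _ => hz c hc) (Set.subset_insert z s)]
      exact Set.mem_insert z s
    refine ⟨fun x hx y hy hxy => ?_, Set.Subset.antisymm ?_ fun r hr => ?_⟩
    · by_contra hne
      rcases hs.1.total hx hy with hle | hle
      · exact (hρ (hle.lt_of_ne hne)).ne hxy
      · exact (hρ (hle.lt_of_ne (Ne.symm hne))).ne hxy.symm
    · rintro _ ⟨x, -, rfl⟩
      exact ⟨hρ.monotone (ha₀ x), hρ.monotone (hb₀ x)⟩
    · by_contra hr'
      have hne : ∀ x ∈ s, ρ x ≠ r := fun x hx h => hr' ⟨x, hx, h⟩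
      have ha₀s := hmem a₀ fun c _ => Or.inl (ha₀ c)
      have hb₀s := hmem b₀ fun c _ => Or.inr (hb₀ c)
      obtain ⟨_, ⟨⟨a, ⟨ha, har⟩, rfl⟩, hamax⟩⟩ :
          ∃ m, IsGreatest (ρ '' {x | x ∈ s ∧ ρ x < r}) m := by
        refine BddAbove.exists_isGreatest_of_nonempty ⟨r, ?_⟩
          ⟨_, a₀, ⟨ha₀s, hr.1.lt_of_ne (hne _ ha₀s)⟩, rfl⟩
        rintro _ ⟨x, hx, rfl⟩
        exact hx.2.le
      obtain ⟨_, ⟨⟨b, ⟨hb, hbr⟩, rfl⟩, hbmin⟩⟩ :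
          ∃ m, IsLeast (ρ '' {x | x ∈ s ∧ r < ρ x}) m :=
        BddBelow.exists_isLeast_of_nonempty (OrderBot.bddBelow _)
          ⟨_, b₀, ⟨hb₀s, hr.2.lt_of_ne (hne _ hb₀s).symm⟩, rfl⟩
      obtain ⟨z, haz, hzb⟩ := h a b (hlt a ha b hb (har.trans hbr)) (by omega)
      have hlow : ∀ c ∈ s, ρ c < r → ρ c ≤ ρ a := fun c hc hcr => hamax ⟨c, ⟨hc, hcr⟩, rfl⟩
      have hhigh : ∀ c ∈ s, r < ρ c → ρ b ≤ ρ c := fun c hc hcr => hbmin ⟨c, ⟨hc, hcr⟩, rfl⟩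
      have hz : z ∈ s := hmem z fun c hc => by
        rcases lt_or_gt_of_ne (hne c hc) with hcr | hcr
        · right
          refine le_trans ?_ haz.le
          by_contra hca
          exact (hlow c hc hcr).not_gt
            (hρ ((hs.1.total hc ha).resolve_left hca |>.lt_of_not_ge hca))
        · left
          refine hzb.le.trans ?_
          by_contra hcb
          exact (hhigh c hc hcr).not_gt
            (hρ ((hs.1.total hb hc).resolve_left hcb |>.lt_of_not_ge hcb))
      rcases lt_or_gt_of_ne (hne z hz) with hzr | hzr
      · exact (hlow z hz hzr).not_gt (hρ haz)
      · exact (hhigh z hz hzr).not_gt (hρ hzb)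
  refine ⟨⟨a₀, ha₀⟩, ⟨b₀, hb₀⟩, fun s t hs ht => ?_⟩
  rw [← (key s hs).1.encard_image, (key s hs).2, ← (key t ht).2, (key t ht).1.encard_image]

theorem posetChain_length_le {m a : ℕ} (f : Q → ℕ) (hf : StrictAnti f)
    (hm : ∀ z, a < f z ∧ f z ≤ a + m) {j : ℕ} (c : PosetChain Q j) : j ≤ m := by
  have := Finset.card_le_card_of_injOn (s := Finset.univ) (t := Finset.Ioc a (a + m))
    (fun i => f (c i)) (fun i _ => Finset.mem_coe.2 (Finset.mem_Ioc.2 (hm _)))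
    ((hf.comp_strictMono c.strictMono).injective.injOn)
  simpa using this

theorem orderComplexDim_le {m : ℕ} (h : ∀ j, Nonempty (PosetChain Q j) → j ≤ m) :
    orderComplexDim Q ≤ (m : ℤ) - 1 := by
  have : sSup {j : ℕ | Nonempty (PosetChain Q j)} ≤ m := csSup_le' h
  unfold orderComplexDim
  omega

theorem orderComplexDim_eq {m : ℕ} (h : ∀ j, Nonempty (PosetChain Q j) → j ≤ m)
    (hm : Nonempty (PosetChain Q m)) : orderComplexDim Q = (m : ℤ) - 1 := by
  have : sSup {j : ℕ | Nonempty (PosetChain Q j)} = m :=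
    IsGreatest.csSup_eq ⟨hm, fun j hj => h j hj⟩
  rw [orderComplexDim, this]

theorem nonempty_posetChain {k : Type*} [Field k] {m : ℕ}
    (h : Module.finrank k (ReducedHomology k Q m) ≠ 0) : Nonempty (PosetChain Q m) := by
  by_contra hempty
  rw [not_nonempty_iff] at hempty
  exact h Module.finrank_zero_of_subsingleton

theorem reducedBetti_of_isSpherical {k : Type*} [Field k] {P : Type*} [PartialOrder P] [Finite P]
    {m b : ℕ} (e : Q ↪o P) (h : IsSpherical k (Set.range e) m b) (i : ℤ) :
    reducedBetti k Q i = if i = (m : ℤ) - 1 then b else 0 := by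
  rw [reducedBetti]
  by_cases hi : -1 ≤ i
  · rw [if_pos hi, finrank_reducedHomology e, h]
    congr 1
    exact propext ⟨fun h => by omega, fun h => by omega⟩
  · rw [if_neg hi, if_neg (by omega)]

end GradedPosets

/-! ### The Möbius function of a Boolean interval -/

section MoebiusFunction

/-- The Möbius function of a Boolean interval. -/
theorem mu_eq_neg_one_pow {L ι : Type*} [PartialOrder L] [LocallyFiniteOrder L] [DecidableEq L]
    [DecidableEq ι] (κ : Finset ι → L) (hle : ∀ S T, κ S ≤ κ T ↔ S ⊆ T)
    (hsurj : ∀ x, κ ∅ ≤ x → ∃ S, κ S = x) (S : Finset ι) :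
    IncidenceAlgebra.mu ℤ (κ ∅) (κ S) = (-1) ^ S.card := by
  have hinj : Function.Injective κ := fun S T h =>
    ((hle S T).1 h.le).antisymm ((hle T S).1 h.ge)
  induction S using Finset.strongInduction with
  | H S ih =>
  rcases S.eq_empty_or_nonempty with rfl | hS
  · simp
  have hIco : Finset.Ico (κ ∅) (κ S) = S.ssubsets.image κ := by
    ext x
    rw [Finset.mem_Ico, Finset.mem_image]
    constructor
    · rintro ⟨h1, h2⟩
      obtain ⟨T, rfl⟩ := hsurj x h1
      refine ⟨T, Finset.mem_ssubsets.2 (((hle T S).1 h2.le).ssubset_of_ne ?_), rfl⟩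
      rintro rfl
      exact lt_irrefl _ h2
    · rintro ⟨T, hT, rfl⟩
      rw [Finset.mem_ssubsets] at hT
      exact ⟨(hle _ _).2 (Finset.empty_subset T),
        ((hle T S).2 hT.1).lt_of_ne fun h => hT.ne (hinj h)⟩
  have hsum : ∑ x ∈ Finset.Ico (κ ∅) (κ S), IncidenceAlgebra.mu ℤ (κ ∅) x =
      ∑ T ∈ S.ssubsets, (-1) ^ T.card := by
    rw [hIco, Finset.sum_image hinj.injOn]
    exact Finset.sum_congr rfl fun T hT => ih T (Finset.mem_ssubsets.1 hT)
  have hpow := Finset.sum_powerset_neg_one_pow_card_of_nonempty hS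
  rw [← Finset.insert_erase (Finset.mem_powerset_self S),
    Finset.sum_insert (Finset.notMem_erase _ _)] at hpow
  rw [IncidenceAlgebra.mu_eq_neg_sum_Ico_of_ne fun h => hS.ne_empty (hinj h).symm, hsum]
  exact (eq_neg_of_add_eq_zero_left hpow).symm

end MoebiusFunction

/-! ### Boolean intervals of subgroups -/

section BooleanIntervals

variable {G : Type*} [Group G] {H : Subgroup G} {ι : Type*}
  (e : Set.Icc H (⊤ : Subgroup G) ≃o Finset ι)

/-- The element of the Boolean interval `[H, G]` corresponding to a set of indices. -/
def intervalSubgroup (S : Finset ι) : Subgroup G := (e.symm S).1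

theorem le_intervalSubgroup (S : Finset ι) : H ≤ intervalSubgroup e S := (e.symm S).2.1

theorem intervalSubgroup_le_iff {S T : Finset ι} :
    intervalSubgroup e S ≤ intervalSubgroup e T ↔ S ⊆ T :=
  e.symm.le_iff_le

theorem exists_intervalSubgroup_eq {L : Subgroup G} (hL : H ≤ L) :
    ∃ S, intervalSubgroup e S = L :=
  ⟨e ⟨L, hL, le_top⟩, by rw [intervalSubgroup, e.symm_apply_apply]⟩

theorem intervalSubgroup_empty : intervalSubgroup e ∅ = H := by
  obtain ⟨S, hS⟩ := exists_intervalSubgroup_eq e le_rfl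
  refine le_antisymm ?_ (le_intervalSubgroup e _)
  conv_rhs => rw [← hS]
  exact (intervalSubgroup_le_iff e).2 (Finset.empty_subset S)

theorem intervalSubgroup_eq_top_iff [Fintype ι] {S : Finset ι} :
    intervalSubgroup e S = ⊤ ↔ S = Finset.univ := by
  obtain ⟨T, hT⟩ := exists_intervalSubgroup_eq e (le_top : H ≤ ⊤)
  have hTuniv : T = Finset.univ := Finset.eq_univ_of_forall fun i => by
    have h : intervalSubgroup e {i} ≤ intervalSubgroup e T := hT ▸ le_top
    exact Finset.singleton_subset_iff.1 ((intervalSubgroup_le_iff e).1 h)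
  subst hTuniv
  refine ⟨fun h => Finset.univ_subset_iff.1 ((intervalSubgroup_le_iff e).1 (by rw [h, hT])), ?_⟩
  rintro rfl
  exact hT

variable [Fintype ι] [DecidableEq ι]

/-- The maximal subgroups in the Boolean interval `[H, G]`. -/
def coatomSubgroup (i : ι) : Subgroup G := intervalSubgroup e {i}ᶜ

theorem coatomSubgroup_ne_top (i : ι) : coatomSubgroup e i ≠ ⊤ := fun h => by
  have := (intervalSubgroup_eq_top_iff e).1 h
  exact (Finset.mem_compl.1 (this ▸ Finset.mem_univ i)) (Finset.mem_singleton_self i)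

theorem intervalSubgroup_le_coatomSubgroup_iff {S : Finset ι} {i : ι} :
    intervalSubgroup e S ≤ coatomSubgroup e i ↔ i ∉ S := by
  rw [coatomSubgroup, intervalSubgroup_le_iff, Finset.subset_compl_comm,
    Finset.singleton_subset_iff, Finset.mem_compl]

theorem mem_intervalSubgroup_iff {S : Finset ι} {g : G} :
    g ∈ intervalSubgroup e S ↔ ∀ i ∉ S, g ∈ coatomSubgroup e i := by
  refine ⟨fun hg i hi => (intervalSubgroup_le_coatomSubgroup_iff e).2 hi hg, fun hg => ?_⟩
  obtain ⟨T, hT⟩ := exists_intervalSubgroup_eq e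
    (le_iInf₂ fun i (_ : i ∉ S) => le_intervalSubgroup e {i}ᶜ : H ≤ ⨅ i ∉ S, coatomSubgroup e i)
  have hTS : T ⊆ S := fun i hi => by
    by_contra hiS
    have : intervalSubgroup e T ≤ coatomSubgroup e i := hT ▸ iInf₂_le i hiS
    exact (intervalSubgroup_le_coatomSubgroup_iff e).1 this hi
  refine (intervalSubgroup_le_iff e).2 hTS ?_
  rw [hT]
  simpa [Subgroup.mem_iInf] using hg

theorem mem_iff_forall_mem_coatomSubgroup {g : G} : g ∈ H ↔ ∀ i, g ∈ coatomSubgroup e i := by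
  conv_lhs => rw [← intervalSubgroup_empty e]
  simp [mem_intervalSubgroup_iff]

theorem mul_coatomSubgroup (hCompl : IsGroupComplemented H) (i : ι) :
    (intervalSubgroup e {i} : Set G) * (coatomSubgroup e i : Set G) = Set.univ := by
  refine hCompl _ _ (le_intervalSubgroup e _) (le_intervalSubgroup e _) ?_ ?_
  · obtain ⟨T, hT⟩ := exists_intervalSubgroup_eq e
      (le_inf (le_intervalSubgroup e {i}) (le_intervalSubgroup e {i}ᶜ))
    have h1 : T ⊆ {i} := (intervalSubgroup_le_iff e).1 (hT ▸ inf_le_left)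
    have h2 : T ⊆ {i}ᶜ := (intervalSubgroup_le_iff e).1 (hT ▸ inf_le_right)
    have hT0 : T = ∅ := Finset.disjoint_self_iff_empty _ |>.1
      (Finset.disjoint_of_subset_left h1 (Finset.disjoint_of_subset_right h2 disjoint_compl_right))
    rw [coatomSubgroup, ← hT, hT0, intervalSubgroup_empty]
  · obtain ⟨T, hT⟩ := exists_intervalSubgroup_eq e
      ((le_intervalSubgroup e {i}).trans (le_sup_left (b := intervalSubgroup e {i}ᶜ)))
    have h1 : {i} ⊆ T := (intervalSubgroup_le_iff e).1 (hT ▸ le_sup_left)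
    have h2 : {i}ᶜ ⊆ T := (intervalSubgroup_le_iff e).1 (hT ▸ le_sup_right)
    rw [coatomSubgroup, ← hT, intervalSubgroup_eq_top_iff, ← Finset.univ_subset_iff,
      ← Finset.union_compl {i}]
    exact Finset.union_subset h1 h2

/-- Cosets of different maximal subgroups of a group-complemented Boolean interval have a common
element. -/
theorem exists_common_representative (hCompl : IsGroupComplemented H) (J : Finset ι) (a : ι → G) :
    ∃ g : G, ∀ i ∈ J, g * (a i)⁻¹ ∈ coatomSubgroup e i := by
  induction J using Finset.induction_on with
  | empty => exact ⟨1, by simp⟩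
  | insert j J hj ih =>
    obtain ⟨g, hg⟩ := ih
    -- correct `g` by an element of the atom `{j}`, which is contained in the other coatoms
    have h : g * (a j)⁻¹ ∈ (intervalSubgroup e {j} : Set G) * (coatomSubgroup e j : Set G) := by
      rw [mul_coatomSubgroup e hCompl]; trivial
    obtain ⟨x, hx, y, hy, hxy⟩ := h
    have hxy : x * y = g * (a j)⁻¹ := hxy
    refine ⟨x⁻¹ * g, fun i hi => ?_⟩
    rw [mul_assoc]
    rcases Finset.mem_insert.1 hi with rfl | hiJ
    · rw [← hxy, inv_mul_cancel_left]
      exact hy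
    · refine mul_mem (inv_mem ?_) (hg i hiJ)
      refine (intervalSubgroup_le_coatomSubgroup_iff e).2 ?_ hx
      rw [Finset.mem_singleton]
      rintro rfl
      exact hj hiJ

end BooleanIntervals

/-! ### Indices and Euler totients -/

section Totients

variable {G : Type*} [Group G] {H : Subgroup G} {ι : Type*} [Fintype ι] [DecidableEq ι]
  (e : Set.Icc H (⊤ : Subgroup G) ≃o Finset ι)

theorem mk_inv_eq_mk_inv_iff {K : Subgroup G} {g h : G} :
    ((g⁻¹ : G) : G ⧸ K) = ((h⁻¹ : G) : G ⧸ K) ↔ g * h⁻¹ ∈ K := by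
  rw [QuotientGroup.eq, inv_inv]

theorem exists_forall_mk_inv_eq (hCompl : IsGroupComplemented H)
    (q : ∀ i, G ⧸ coatomSubgroup e i) :
    ∃ g : G, ∀ i, ((g⁻¹ : G) : G ⧸ coatomSubgroup e i) = q i := by
  obtain ⟨g, hg⟩ := exists_common_representative e hCompl Finset.univ fun i => (q i).out⁻¹
  refine ⟨g, fun i => ?_⟩
  have := mk_inv_eq_mk_inv_iff.2 (hg i (Finset.mem_univ i))
  rwa [inv_inv, QuotientGroup.out_eq'] at this

theorem index_intervalSubgroup (hCompl : IsGroupComplemented H) (S : Finset ι) :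
    (intervalSubgroup e S).index = ∏ i ∈ Sᶜ, (coatomSubgroup e i).index := by
  let f : G ⧸ intervalSubgroup e S → ∀ i : ↥(Sᶜ), G ⧸ coatomSubgroup e (i : ι) :=
    Quotient.lift (fun g i => (g : G ⧸ coatomSubgroup e (i : ι))) fun g h hgh => by
      funext i
      exact QuotientGroup.eq.2 ((intervalSubgroup_le_coatomSubgroup_iff e).2
        (Finset.mem_compl.1 i.2) (QuotientGroup.leftRel_apply.1 hgh))
  have hf : Function.Bijective f := by
    constructor
    · rintro ⟨g⟩ ⟨h⟩ hgh
      refine QuotientGroup.eq.2 ((mem_intervalSubgroup_iff e).2 fun i hi => ?_)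
      exact QuotientGroup.eq.1 (congrFun hgh ⟨i, Finset.mem_compl.2 hi⟩)
    · intro q
      classical
      obtain ⟨g, hg⟩ := exists_forall_mk_inv_eq e hCompl fun i =>
        if hi : i ∈ Sᶜ then q ⟨i, hi⟩ else ((1 : G) : G ⧸ coatomSubgroup e i)
      refine ⟨((g⁻¹ : G) : G ⧸ intervalSubgroup e S), funext fun i => ?_⟩
      exact (hg i).trans (dif_pos i.2)
  rw [Subgroup.index, Nat.card_eq_of_bijective f hf, Nat.card_pi]
  exact Finset.prod_coe_sort Sᶜ fun i => (coatomSubgroup e i).index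

theorem closure_rightCoset_eq_top_iff (g : G) :
    Subgroup.closure (MulOpposite.op g • (H : Set G)) = ⊤ ↔ ∀ i, g ∉ coatomSubgroup e i := by
  have hg : g ∈ Subgroup.closure (MulOpposite.op g • (H : Set G)) :=
    Subgroup.subset_closure ((mem_rightCoset_iff g).2 (by simp))
  have hH : H ≤ Subgroup.closure (MulOpposite.op g • (H : Set G)) := fun h hh => by
    have : h * g ∈ Subgroup.closure (MulOpposite.op g • (H : Set G)) :=
      Subgroup.subset_closure ((mem_rightCoset_iff g).2 (by simpa using hh))
    simpa using mul_mem this (inv_mem hg)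
  constructor
  · intro htop i hi
    refine coatomSubgroup_ne_top e i (top_le_iff.1
      (htop ▸ (Subgroup.closure_le _).2 fun y hy => ?_))
    have := le_intervalSubgroup e {i}ᶜ ((mem_rightCoset_iff g).1 hy)
    simpa using (coatomSubgroup e i).mul_mem this hi
  · intro hnot
    obtain ⟨S, hS⟩ := exists_intervalSubgroup_eq e hH
    rw [← hS, intervalSubgroup_eq_top_iff]
    by_contra hne
    obtain ⟨i, hi⟩ : ∃ i, i ∉ S := by
      by_contra hall
      push Not at hall
      exact hne (Finset.eq_univ_of_forall hall)
    exact hnot i ((intervalSubgroup_le_coatomSubgroup_iff e).2 hi (hS ▸ hg))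

variable [Finite G]

theorem dualEulerTotient_eq (hCompl : IsGroupComplemented H) :
    dualEulerTotient H = ∏ i, (((coatomSubgroup e i).index : ℤ) - 1) := by
  classical
  have hinj : Function.Injective (intervalSubgroup e) := fun S T h =>
    ((intervalSubgroup_le_iff e).1 h.le).antisymm ((intervalSubgroup_le_iff e).1 h.ge)
  unfold dualEulerTotient
  let : Fintype (Subgroup G) := Fintype.ofFinite _
  let : LocallyFiniteOrder (Subgroup G) := Fintype.toLocallyFiniteOrder
  have hIcc : Finset.Icc H ⊤ = Finset.univ.image (intervalSubgroup e) := by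
    ext L
    rw [Finset.mem_Icc, Finset.mem_image]
    constructor
    · rintro ⟨h, -⟩
      obtain ⟨S, hS⟩ := exists_intervalSubgroup_eq e h
      exact ⟨S, Finset.mem_univ S, hS⟩
    · rintro ⟨S, -, rfl⟩
      exact ⟨le_intervalSubgroup e S, le_top⟩
  rw [hIcc, Finset.sum_image hinj.injOn]
  simp_rw [sub_eq_neg_add, Finset.prod_add, Finset.powerset_univ]
  refine Finset.sum_congr rfl fun S _ => ?_
  have hmu := mu_eq_neg_one_pow (intervalSubgroup e) (fun S T => intervalSubgroup_le_iff e)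
    (fun x hx => exists_intervalSubgroup_eq e (by rwa [intervalSubgroup_empty] at hx)) S
  rw [intervalSubgroup_empty] at hmu
  rw [hmu, index_intervalSubgroup e hCompl, Finset.prod_const, Nat.cast_prod,
    Finset.compl_eq_univ_sdiff]

theorem card_ne_eq_index_sub_one (K : Subgroup G) :
    Nat.card {q : G ⧸ K // q ≠ ((1 : G) : G ⧸ K)} = K.index - 1 := by
  classical
  have := Fintype.ofFinite (G ⧸ K)
  rw [Subgroup.index, Nat.card_eq_fintype_card, Nat.card_eq_fintype_card]
  exact Set.card_ne_eq _

theorem eulerTotient_eq (hCompl : IsGroupComplemented H) :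
    eulerTotient H = ∏ i, ((coatomSubgroup e i).index - 1) := by
  choose γ hγ using exists_forall_mk_inv_eq e hCompl
  let f : (∀ i, {q : G ⧸ coatomSubgroup e i // q ≠ ((1 : G) : G ⧸ coatomSubgroup e i)}) →
      {s : Set G | (∃ g : G, s = MulOpposite.op g • (H : Set G)) ∧ Subgroup.closure s = ⊤} :=
    fun q => ⟨MulOpposite.op (γ fun i => (q i).1) • (H : Set G), ⟨_, rfl⟩,
      (closure_rightCoset_eq_top_iff e _).2 fun i hi => (q i).2 <| by
        rw [← hγ (fun i => (q i).1) i, QuotientGroup.eq, inv_inv, mul_one]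
        exact hi⟩
  have hcoset : ∀ g g' : G, MulOpposite.op g • (H : Set G) = MulOpposite.op g' • (H : Set G) ↔
      ∀ i, ((g⁻¹ : G) : G ⧸ coatomSubgroup e i) = ((g'⁻¹ : G) : G ⧸ coatomSubgroup e i) := by
    intro g g'
    rw [eq_comm, rightCoset_eq_iff, mem_iff_forall_mem_coatomSubgroup e]
    exact forall_congr' fun i => mk_inv_eq_mk_inv_iff.symm
  have hf : Function.Bijective f := by
    constructor
    · intro q q' h
      have := (hcoset _ _).1 (congrArg Subtype.val h)
      funext i
      rw [Subtype.ext_iff, ← hγ (fun i => (q i).1) i, ← hγ (fun i => (q' i).1) i, this]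
    · rintro ⟨s, ⟨g, rfl⟩, hs⟩
      refine ⟨fun i => ⟨((g⁻¹ : G) : G ⧸ coatomSubgroup e i), fun h => ?_⟩, Subtype.ext ?_⟩
      · rw [QuotientGroup.eq, inv_inv, mul_one] at h
        exact (closure_rightCoset_eq_top_iff e g).1 hs i h
      · exact (hcoset _ _).2 fun i => hγ _ i
  rw [eulerTotient, ← Nat.card_coe_set_eq, ← Nat.card_eq_of_bijective f hf, Nat.card_pi]
  exact Finset.prod_congr rfl fun i _ => card_ne_eq_index_sub_one _

theorem one_lt_index_coatomSubgroup (i : ι) : 1 < (coatomSubgroup e i).index :=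
  Subgroup.one_lt_index_of_ne_top (coatomSubgroup_ne_top e i)

end Totients

/-! ### Cosets as partial transversals -/

section CosetPoset

open OrderDual

variable {G : Type*} [Group G] {H : Subgroup G}

/-- All the right cosets `Kg` with `H ≤ K ≤ G`, including `G` itself. -/
def intervalCosets (H : Subgroup G) : Set (Set G) :=
  {s | ∃ K : Subgroup G, H ≤ K ∧ ∃ g : G, s = MulOpposite.op g • (K : Set G)}

theorem mem_op_smul_self (K : Subgroup G) (g : G) : g ∈ MulOpposite.op g • (K : Set G) :=
  (mem_rightCoset_iff g).2 (by simp)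

theorem ne_empty_of_mem_intervalCosets {s : Set G} (hs : s ∈ intervalCosets H) : s ≠ ∅ := by
  obtain ⟨K, -, g, rfl⟩ := hs
  exact Set.nonempty_iff_ne_empty.1 ⟨g, mem_op_smul_self K g⟩

theorem univ_mem_intervalCosets : Set.univ ∈ intervalCosets H :=
  ⟨⊤, le_top, 1, by simp⟩

theorem op_smul_eq_univ_iff {K : Subgroup G} {g : G} :
    MulOpposite.op g • (K : Set G) = Set.univ ↔ K = ⊤ := by
  constructor
  · intro h
    refine (Subgroup.eq_top_iff' K).2 fun x => ?_
    have : x * g ∈ MulOpposite.op g • (K : Set G) := by rw [h]; trivial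
    simpa using (mem_rightCoset_iff g).1 this
  · rintro rfl
    simp

theorem mem_cosetPoset_iff {s : Set G} :
    s ∈ cosetPoset H ↔ s ∈ intervalCosets H ∧ s ≠ Set.univ := by
  constructor
  · rintro ⟨K, hK, hlt, g, rfl⟩
    exact ⟨⟨K, hK, g, rfl⟩, fun h => hlt.ne (op_smul_eq_univ_iff.1 h)⟩
  · rintro ⟨⟨K, hK, g, rfl⟩, h⟩
    exact ⟨K, hK, lt_top_iff_ne_top.2 fun h' => h (op_smul_eq_univ_iff.2 h'), g, rfl⟩

theorem mem_boundedCosetPoset_iff {s : Set G} :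
    s ∈ boundedCosetPoset H ↔ s = ∅ ∨ s ∈ intervalCosets H := by
  simp only [boundedCosetPoset, Set.mem_union, mem_cosetPoset_iff, Set.mem_insert_iff,
    Set.mem_singleton_iff]
  constructor
  · rintro (h | h | rfl)
    · exact Or.inr h.1
    · exact Or.inl h
    · exact Or.inr univ_mem_intervalCosets
  · rintro (h | h)
    · exact Or.inr (Or.inl h)
    · by_cases hs : s = Set.univ
      · exact Or.inr (Or.inr hs)
      · exact Or.inl ⟨h, hs⟩

variable {ι : Type*} [Fintype ι] [DecidableEq ι] (e : Set.Icc H (⊤ : Subgroup G) ≃o Finset ι)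

/-- The cosets of the maximal subgroups `Mᵢ` of the interval `[H, G]`. The right coset `Mᵢ g` is
encoded as the left coset `g⁻¹ Mᵢ`. -/
abbrev CoatomCoset := Σ i : ι, G ⧸ coatomSubgroup e i

variable {e} in
theorem card_le_of_injOn {σ : Finset (CoatomCoset e)}
    (hσ : Set.InjOn Sigma.fst (σ : Set (CoatomCoset e))) : σ.card ≤ Fintype.card ι :=
  Finset.card_le_card_of_injOn Sigma.fst (fun _ _ => Finset.mem_univ _) hσ

variable {e} in
theorem card_filter_fst_eq [Fintype (CoatomCoset e)] (i : ι) :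
    (Finset.univ.filter fun v : CoatomCoset e => v.1 = i).card = (coatomSubgroup e i).index := by
  rw [← Fintype.card_subtype, ← Nat.card_eq_fintype_card, Subgroup.index]
  exact Nat.card_congr (Equiv.sigmaSubtype i)

variable [Finite G]

/-- The cosets of maximal subgroups of `[H, G]` containing a given subset of `G`. -/
def containingCosets (s : Set G) : Finset (CoatomCoset e) :=
  (Set.toFinite {v : CoatomCoset e |
    ∀ y ∈ s, ((y⁻¹ : G) : G ⧸ coatomSubgroup e v.1) = v.2}).toFinset

variable {e}

theorem mem_containingCosets {s : Set G} {v : CoatomCoset e} : v ∈ containingCosets e s ↔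
    ∀ y ∈ s, ((y⁻¹ : G) : G ⧸ coatomSubgroup e v.1) = v.2 := by
  rw [containingCosets, Set.Finite.mem_toFinset, Set.mem_ofPred_eq]

theorem mem_containingCosets_op_smul {S : Finset ι} {g : G} {v : CoatomCoset e} :
    v ∈ containingCosets e (MulOpposite.op g • (intervalSubgroup e S : Set G)) ↔
      v.1 ∉ S ∧ ((g⁻¹ : G) : G ⧸ coatomSubgroup e v.1) = v.2 := by
  rw [mem_containingCosets]
  constructor
  · intro h
    have hg := h g (mem_op_smul_self _ g)
    refine ⟨(intervalSubgroup_le_coatomSubgroup_iff e).1 fun x hx => ?_, hg⟩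
    have := h (x * g) ((mem_rightCoset_iff g).2 (by simpa using hx))
    rw [← hg, mk_inv_eq_mk_inv_iff] at this
    simpa using this
  · rintro ⟨hv, hg⟩ y hy
    rw [← hg, mk_inv_eq_mk_inv_iff]
    exact (intervalSubgroup_le_coatomSubgroup_iff e).2 hv ((mem_rightCoset_iff g).1 hy)

theorem containingCosets_anti {s t : Set G} (h : s ⊆ t) :
    containingCosets e t ⊆ containingCosets e s := fun _ hv =>
  mem_containingCosets.2 fun y hy => mem_containingCosets.1 hv y (h hy)

/-- A coset `Kg` is the intersection of the cosets of maximal subgroups which contain it. -/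
theorem containingCosets_subset_iff {s t : Set G} (ht : t ∈ intervalCosets H) :
    containingCosets e t ⊆ containingCosets e s ↔ s ⊆ t := by
  refine ⟨fun h y hy => ?_, containingCosets_anti⟩
  obtain ⟨K, hK, g, rfl⟩ := ht
  obtain ⟨S, rfl⟩ := exists_intervalSubgroup_eq e hK
  refine (mem_rightCoset_iff g).2 ((mem_intervalSubgroup_iff e).2 fun i hi => ?_)
  have hv : (⟨i, ((g⁻¹ : G) : G ⧸ coatomSubgroup e i)⟩ : CoatomCoset e) ∈
      containingCosets e (MulOpposite.op g • (intervalSubgroup e S : Set G)) :=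
    mem_containingCosets_op_smul.2 ⟨hi, rfl⟩
  exact mk_inv_eq_mk_inv_iff.1 (mem_containingCosets.1 (h hv) y hy)

theorem containingCosets_ssubset_iff {s t : Set G} (hs : s ∈ intervalCosets H)
    (ht : t ∈ intervalCosets H) : containingCosets e t ⊂ containingCosets e s ↔ s ⊂ t := by
  rw [ssubset_iff_subset_not_subset, ssubset_iff_subset_not_subset,
    containingCosets_subset_iff ht, containingCosets_subset_iff hs]

theorem containingCosets_univ : containingCosets e Set.univ = ∅ := by
  have h : (Set.univ : Set G) =
      MulOpposite.op (1 : G) • (intervalSubgroup e Finset.univ : Set G) := by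
    rw [eq_comm, op_smul_eq_univ_iff, intervalSubgroup_eq_top_iff]
  refine Finset.eq_empty_of_forall_notMem fun v hv => ?_
  rw [h, mem_containingCosets_op_smul] at hv
  exact hv.1 (Finset.mem_univ _)

theorem injOn_containingCosets {s : Set G} (hs : s ≠ ∅) :
    Set.InjOn Sigma.fst (containingCosets e s : Set (CoatomCoset e)) := by
  obtain ⟨y, hy⟩ := Set.nonempty_iff_ne_empty.2 hs
  rintro ⟨i, q⟩ hq ⟨j, r⟩ hr hij
  obtain rfl : i = j := hij
  have h1 := mem_containingCosets.1 hq y hy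
  have h2 := mem_containingCosets.1 hr y hy
  exact congrArg (Sigma.mk i) (h1.symm.trans h2)

/-- In a group-complemented Boolean interval, every partial transversal of the coset spaces of the
maximal subgroups comes from a coset. -/
theorem exists_containingCosets_eq (hCompl : IsGroupComplemented H) {σ : Finset (CoatomCoset e)}
    (hσ : Set.InjOn Sigma.fst (σ : Set (CoatomCoset e))) :
    ∃ s ∈ intervalCosets H, containingCosets e s = σ := by
  classical
  obtain ⟨g, hg⟩ := exists_forall_mk_inv_eq e hCompl fun i =>
    if h : ∃ q, (⟨i, q⟩ : CoatomCoset e) ∈ σ then h.choose else ((1 : G) : G ⧸ coatomSubgroup e i)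
  have hgσ : ∀ v ∈ σ, ((g⁻¹ : G) : G ⧸ coatomSubgroup e v.1) = v.2 := by
    rintro ⟨i, q⟩ hq
    have h : ∃ q, (⟨i, q⟩ : CoatomCoset e) ∈ σ := ⟨q, hq⟩
    rw [hg i, dif_pos h]
    exact eq_of_heq (Sigma.mk.inj (hσ h.choose_spec hq rfl)).2
  refine ⟨_, ⟨_, le_intervalSubgroup e (σ.image Sigma.fst)ᶜ, g, rfl⟩, ?_⟩
  ext v
  rw [mem_containingCosets_op_smul, Finset.mem_compl, not_not, Finset.mem_image]
  constructor
  · rintro ⟨⟨w, hw, hwv⟩, hv⟩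
    obtain ⟨i, q⟩ := v
    obtain ⟨j, r⟩ := w
    obtain rfl : j = i := hwv
    obtain rfl : r = q := (hgσ _ hw).symm.trans hv
    exact hw
  · exact fun hv => ⟨⟨v, hv, rfl⟩, hgσ v hv⟩

/-- Ordering the cosets `Kg` by inclusion amounts to ordering the corresponding partial
transversals by reverse inclusion. -/
def transversalEmbedding {Q : Type*} [PartialOrder Q] (f : Q ↪o Set G)
    (hf : ∀ z, f z ∈ intervalCosets H) : Q ↪o (Finset (CoatomCoset e))ᵒᵈ :=
  OrderEmbedding.ofMapLEIff (fun z => toDual (containingCosets e (f z))) fun a b => by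
    rw [toDual_le_toDual, containingCosets_subset_iff (hf b)]
    exact f.le_iff_le

theorem range_transversalEmbedding {Q : Type*} [PartialOrder Q] (f : Q ↪o Set G)
    (hf : ∀ z, f z ∈ intervalCosets H) {A : Set (Finset (CoatomCoset e))}
    (hA : ∀ σ, σ ∈ A ↔ ∃ z, containingCosets e (f z) = σ) :
    Set.range (transversalEmbedding (e := e) f hf) = reverseFamily A := by
  ext σ
  exact (hA (ofDual σ)).symm

theorem strictAnti_card_containingCosets {Q : Type*} [PartialOrder Q] (f : Q ↪o Set G)
    (hf : ∀ z, f z ∈ intervalCosets H) :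
    StrictAnti fun z => (containingCosets e (f z)).card := fun a b hab =>
  Finset.card_lt_card ((containingCosets_ssubset_iff (hf a) (hf b)).2 (f.strictMono hab))

theorem card_containingCosets_rightCoset (g : G) :
    (containingCosets e (MulOpposite.op g • (H : Set G))).card = Fintype.card ι := by
  have hH : MulOpposite.op g • (H : Set G) =
      MulOpposite.op g • (intervalSubgroup e ∅ : Set G) := by
    rw [intervalSubgroup_empty]
  have h : containingCosets e (MulOpposite.op g • (H : Set G)) = Finset.univ.map
      ⟨fun i => (⟨i, ((g⁻¹ : G) : G ⧸ coatomSubgroup e i)⟩ : CoatomCoset e),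
        fun i j hij => congrArg Sigma.fst hij⟩ := by
    ext ⟨i, q⟩
    rw [hH, mem_containingCosets_op_smul]
    simp only [Finset.mem_map, Finset.mem_univ, true_and]
    constructor
    · rintro ⟨-, rfl⟩
      exact ⟨i, rfl⟩
    · rintro ⟨j, hj⟩
      obtain rfl : j = i := congrArg Sigma.fst hj
      exact ⟨Finset.notMem_empty _, eq_of_heq (Sigma.mk.inj hj).2⟩
  rw [h, Finset.card_map, Finset.card_univ]

theorem isGradedPoset_boundedCosetPoset (hCompl : IsGroupComplemented H)
    (e : Set.Icc H (⊤ : Subgroup G) ≃o Finset ι) : IsGradedPoset (boundedCosetPoset H) := by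
  classical
  have hcoset : ∀ z : boundedCosetPoset H, z.1 ≠ ∅ → z.1 ∈ intervalCosets H := fun z hz =>
    (mem_boundedCosetPoset_iff.1 z.2).resolve_left hz
  have hle : ∀ z : boundedCosetPoset H, z.1 ≠ ∅ →
      (containingCosets e z.1).card ≤ Fintype.card ι := fun z hz =>
    card_le_of_injOn (injOn_containingCosets hz)
  refine isGradedPoset_of_rank
    (fun z => if z.1 = ∅ then 0 else Fintype.card ι + 1 - (containingCosets e z.1).card)
    (fun a b hab => ?_) (a₀ := ⟨∅, mem_boundedCosetPoset_iff.2 (Or.inl rfl)⟩)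
    (b₀ := ⟨Set.univ, mem_boundedCosetPoset_iff.2 (Or.inr univ_mem_intervalCosets)⟩)
    (fun z => Set.empty_subset z.1) (fun z => Set.subset_univ z.1) (fun a b hab hr => ?_)
  · have hab' : a.1 ⊂ b.1 := hab
    have hb : b.1 ≠ ∅ := (Set.nonempty_of_ssubset' hab').ne_empty
    have := hle b hb
    by_cases ha : a.1 = ∅
    · simp only [ha, hb, if_true, if_false]
      omega
    · have hlt := Finset.card_lt_card
        ((containingCosets_ssubset_iff (e := e) (hcoset a ha) (hcoset b hb)).2 hab')
      have := hle a ha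
      simp only [ha, hb, if_false]
      omega
  · have hab' : a.1 ⊂ b.1 := hab
    have hb : b.1 ≠ ∅ := (Set.nonempty_of_ssubset' hab').ne_empty
    by_cases ha : a.1 = ∅
    · -- a coset `Hg` contained in `b`
      simp only [ha, hb, if_true, if_false] at hr
      obtain ⟨g, hg⟩ := Set.nonempty_iff_ne_empty.2 hb
      have hz : MulOpposite.op g • (H : Set G) ∈ intervalCosets H := ⟨H, le_rfl, g, rfl⟩
      have hzb : MulOpposite.op g • (H : Set G) ⊆ b.1 := by
        obtain ⟨K, hK, k, hbK⟩ := hcoset b hb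
        rw [hbK, mem_rightCoset_iff] at hg
        intro y hy
        rw [hbK, mem_rightCoset_iff]
        simpa using mul_mem (hK ((mem_rightCoset_iff g).1 hy)) hg
      have hne : MulOpposite.op g • (H : Set G) ≠ b.1 := by
        intro h
        rw [← h, card_containingCosets_rightCoset] at hr
        omega
      refine ⟨⟨_, mem_boundedCosetPoset_iff.2 (Or.inr hz)⟩, ?_, hzb.ssubset_of_ne hne⟩
      change a.1 ⊂ _
      rw [ha]
      exact Set.empty_ssubset.2 ⟨g, mem_op_smul_self H g⟩
    · simp only [ha, hb, if_false] at hr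
      have hss := (containingCosets_ssubset_iff (e := e) (hcoset a ha) (hcoset b hb)).2 hab'
      have := hle a ha
      obtain ⟨v, hva, hvb⟩ := Finset.exists_of_ssubset hss
      have hsub : insert v (containingCosets e b.1) ⊆ containingCosets e a.1 :=
        Finset.insert_subset hva hss.1
      obtain ⟨z, hz, hzv⟩ := exists_containingCosets_eq hCompl
        ((injOn_containingCosets ha).mono (Finset.coe_subset.2 hsub))
      have hcard := Finset.card_insert_of_notMem hvb
      refine ⟨⟨z, mem_boundedCosetPoset_iff.2 (Or.inr hz)⟩, ?_, ?_⟩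
      · refine (containingCosets_ssubset_iff (e := e) (hcoset a ha) hz).1 ?_
        rw [hzv]
        refine hsub.ssubset_of_ne fun h => ?_
        rw [h] at hcard
        omega
      · refine (containingCosets_ssubset_iff (e := e) hz (hcoset b hb)).1 ?_
        rw [hzv]
        exact Finset.ssubset_insert hvb

/-- The open intervals of the bounded coset poset are spherical, of the expected dimension. -/
theorem exists_isSpherical_Ioo (k : Type*) [Field k] (hCompl : IsGroupComplemented H)
    (e : Set.Icc H (⊤ : Subgroup G) ≃o Finset ι) {x y : boundedCosetPoset H} (hxy : x < y) :
    ∃ m b : ℕ, orderComplexDim (Set.Ioo x y) ≤ (m : ℤ) - 1 ∧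
      ∀ i, reducedBetti k (Set.Ioo x y) i = if i = (m : ℤ) - 1 then b else 0 := by
  classical
  have : Fintype (CoatomCoset e) := Fintype.ofFinite _
  have hxy' : x.1 ⊂ y.1 := hxy
  have hy : y.1 ∈ intervalCosets H := (mem_boundedCosetPoset_iff.1 y.2).resolve_left
    (Set.nonempty_of_ssubset' hxy').ne_empty
  let f : Set.Ioo x y ↪o Set G :=
    (OrderEmbedding.subtype (· ∈ Set.Ioo x y)).trans (OrderEmbedding.subtype _)
  have hfx : ∀ z, x.1 ⊂ f z := fun z => z.2.1
  have hfy : ∀ z, f z ⊂ y.1 := fun z => z.2.2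
  have hf : ∀ z, f z ∈ intervalCosets H := fun z =>
    (mem_boundedCosetPoset_iff.1 z.1.2).resolve_left (Set.nonempty_of_ssubset' (hfx z)).ne_empty
  have hex : ∀ z ∈ intervalCosets H, x.1 ⊂ z → z ⊂ y.1 → ∃ w, f w = z := fun z hz h1 h2 =>
    ⟨⟨⟨z, mem_boundedCosetPoset_iff.2 (Or.inr hz)⟩, h1, h2⟩, rfl⟩
  have hinjy := injOn_containingCosets (e := e) (ne_empty_of_mem_intervalCosets hy)
  set σ := containingCosets e y.1 with hσ
  -- the family `A` of transversals corresponding to the open interval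
  suffices ∃ (m b : ℕ) (A : Set (Finset (CoatomCoset e))),
      (∀ ρ, ρ ∈ A ↔ ∃ z, containingCosets e (f z) = ρ) ∧
      (∀ ρ ∈ A, σ.card < ρ.card ∧ ρ.card ≤ σ.card + m) ∧
      IsSpherical k (reverseFamily A) m b by
    obtain ⟨m, b, A, hA, hcard, hsph⟩ := this
    refine ⟨m, b, orderComplexDim_le fun j ⟨c⟩ => ?_, fun i => ?_⟩
    · exact posetChain_length_le _ (strictAnti_card_containingCosets f hf)
        (fun z => hcard _ ((hA _).2 ⟨z, rfl⟩)) c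
    · exact reducedBetti_of_isSpherical (transversalEmbedding f hf)
        (by rwa [range_transversalEmbedding f hf hA]) i
  rcases mem_boundedCosetPoset_iff.1 x.2 with hx | hx
  · -- the partial transversals extending `σ`
    let W : Finset (CoatomCoset e) := Finset.univ.filter fun v => ∀ s ∈ σ, v.1 ≠ s.1
    refine ⟨(W.image Sigma.fst).card, _, transversals Sigma.fst σ W, fun ρ => ?_, fun ρ hρ => ?_,
      isSpherical_transversals Sigma.fst W hinjy fun w hw => (Finset.mem_filter.1 hw).2⟩
    · constructor
      · rintro ⟨h1, -, h3⟩
        obtain ⟨z, hz, rfl⟩ := exists_containingCosets_eq hCompl h3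
        obtain ⟨w, rfl⟩ := hex z hz (by
          rw [hx]
          exact Set.empty_ssubset.2
            (Set.nonempty_iff_ne_empty.2 (ne_empty_of_mem_intervalCosets hz)))
          ((containingCosets_ssubset_iff hz hy).1 h1)
        exact ⟨w, rfl⟩
      · rintro ⟨z, rfl⟩
        have hinj := injOn_containingCosets (e := e) (ne_empty_of_mem_intervalCosets (hf z))
        have hss := (containingCosets_ssubset_iff (e := e) (hf z) hy).2 (hfy z)
        refine ⟨hss, fun v hv => ?_, hinj⟩
        rw [Finset.mem_union]
        by_cases hvσ : v ∈ σ
        · exact Or.inl hvσ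
        · refine Or.inr (Finset.mem_filter.2 ⟨Finset.mem_univ v, fun s hs hvs => hvσ ?_⟩)
          rw [hinj hv (hss.1 hs) hvs]
          exact hs
    · refine ⟨Finset.card_lt_card hρ.1, ?_⟩
      have h1 : (ρ \ σ).card ≤ (W.image Sigma.fst).card :=
        Finset.card_le_card_of_injOn Sigma.fst
          (fun v hv => by
            rw [Finset.mem_coe, Finset.mem_sdiff] at hv
            exact Finset.mem_image_of_mem _
              ((Finset.mem_union.1 (hρ.2.1 hv.1)).resolve_left hv.2))
          (hρ.2.2.mono (Finset.coe_subset.2 Finset.sdiff_subset))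
      have h2 := Finset.card_sdiff_add_card_eq_card hρ.1.1
      omega
  · -- the sets strictly between `σ` and the transversal of `x`
    have hinjx := injOn_containingCosets (e := e) (ne_empty_of_mem_intervalCosets hx)
    have hss : σ ⊂ containingCosets e x.1 := (containingCosets_ssubset_iff hx hy).2 hxy'
    have hlt := Finset.card_lt_card hss
    refine ⟨(containingCosets e x.1).card - σ.card - 1, 1, Set.Ioo σ (containingCosets e x.1),
      fun ρ => ?_, fun ρ hρ => ?_, isSpherical_Ioo _ hss.1 (by omega)⟩
    · constructor
      · rintro ⟨h1, h2⟩
        obtain ⟨z, hz, rfl⟩ := exists_containingCosets_eq hCompl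
          (hinjx.mono (Finset.coe_subset.2 h2.1))
        obtain ⟨w, rfl⟩ := hex z hz ((containingCosets_ssubset_iff hx hz).1 h2)
          ((containingCosets_ssubset_iff hz hy).1 h1)
        exact ⟨w, rfl⟩
      · rintro ⟨z, rfl⟩
        exact ⟨(containingCosets_ssubset_iff (hf z) hy).2 (hfy z),
          (containingCosets_ssubset_iff hx (hf z)).2 (hfx z)⟩
    · have h1 := Finset.card_lt_card hρ.1
      have h2 := Finset.card_lt_card hρ.2
      omega

/-- The coset poset corresponds to the nonempty partial transversals. -/
theorem cosetPoset_homology (k : Type*) [Field k] (hCompl : IsGroupComplemented H)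
    (e : Set.Icc H (⊤ : Subgroup G) ≃o Finset ι) :
    orderComplexDim (cosetPoset H) = (Fintype.card ι : ℤ) - 1 ∧
      ∀ i, reducedBetti k (cosetPoset H) i =
        if i = (Fintype.card ι : ℤ) - 1 then ∏ i, ((coatomSubgroup e i).index - 1) else 0 := by
  classical
  have : Fintype (CoatomCoset e) := Fintype.ofFinite _
  let f : cosetPoset H ↪o Set G := OrderEmbedding.subtype _
  have hf : ∀ z, f z ∈ intervalCosets H := fun z => (mem_cosetPoset_iff.1 z.2).1
  have hA : ∀ σ, σ ∈ transversals Sigma.fst (∅ : Finset (CoatomCoset e)) Finset.univ ↔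
      ∃ z, containingCosets e (f z) = σ := by
    intro σ
    constructor
    · rintro ⟨h1, -, h3⟩
      obtain ⟨z, hz, rfl⟩ := exists_containingCosets_eq hCompl h3
      refine ⟨⟨z, mem_cosetPoset_iff.2 ⟨hz, ?_⟩⟩, rfl⟩
      rintro rfl
      rw [containingCosets_univ] at h1
      exact h1.ne rfl
    · rintro ⟨z, rfl⟩
      refine ⟨?_, by simp, injOn_containingCosets (ne_empty_of_mem_intervalCosets (hf z))⟩
      rw [← containingCosets_univ, containingCosets_ssubset_iff (hf z) univ_mem_intervalCosets]
      exact (Set.subset_univ _).ssubset_of_ne (mem_cosetPoset_iff.1 z.2).2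
  have himage : (Finset.univ : Finset (CoatomCoset e)).image Sigma.fst = Finset.univ :=
    Finset.eq_univ_of_forall fun i =>
      Finset.mem_image.2 ⟨⟨i, ((1 : G) : G ⧸ coatomSubgroup e i)⟩, Finset.mem_univ _, rfl⟩
  have hsph := isSpherical_transversals (k := k) Sigma.fst
    (Finset.univ : Finset (CoatomCoset e)) (σ₀ := ∅) (by simp) (by simp)
  rw [himage, Finset.card_univ] at hsph
  simp_rw [card_filter_fst_eq] at hsph
  rw [← range_transversalEmbedding f hf hA] at hsph
  have hbetti := finrank_reducedHomology (k := k) (transversalEmbedding (e := e) f hf)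
    (Fintype.card ι)
  rw [hsph, if_pos rfl] at hbetti
  refine ⟨orderComplexDim_eq (fun j ⟨c⟩ => ?_) (nonempty_posetChain (k := k) ?_),
    reducedBetti_of_isSpherical _ hsph⟩
  · refine posetChain_length_le (a := 0) _ (strictAnti_card_containingCosets (e := e) f hf)
      (fun z => ⟨?_, ?_⟩) c
    · exact Finset.card_pos.2 (Finset.empty_ssubset.1 ((hA _).2 ⟨z, rfl⟩).1)
    · rw [zero_add]
      exact card_le_of_injOn ((hA _).2 ⟨z, rfl⟩).2.2
  · -- the top Betti number does not vanish, so there are chains of maximal length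
    rw [hbetti]
    exact Finset.prod_ne_zero_iff.2 fun i _ =>
      Nat.sub_ne_zero_of_lt (one_lt_index_coatomSubgroup e i)

end CosetPoset

end

theorem theorem4p11 {G : Type*} [Group G] [Finite G] (H : Subgroup G) (n : ℕ)
    (hBool : IsBooleanOfRank (Set.Icc H (⊤ : Subgroup G)) n)
    (hCompl : IsGroupComplemented H) :
    IsCohenMacaulayPoset ℂ (boundedCosetPoset H) ∧
    orderComplexDim (cosetPoset H) = (n : ℤ) - 1 ∧
    (∀ i : ℤ, i ≠ (n : ℤ) - 1 → reducedBetti ℂ (cosetPoset H) i = 0) ∧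
    (reducedBetti ℂ (cosetPoset H) ((n : ℤ) - 1) : ℤ) = dualEulerTotient H ∧
    dualEulerTotient H = (eulerTotient H : ℤ) ∧
    eulerTotient H ≠ 0 := by
  obtain ⟨e⟩ := hBool
  obtain ⟨hdim, hbetti⟩ := cosetPoset_homology ℂ hCompl e
  rw [Fintype.card_fin] at hdim hbetti
  have heuler := eulerTotient_eq e hCompl
  have hdual : dualEulerTotient H = (eulerTotient H : ℤ) := by
    rw [dualEulerTotient_eq e hCompl, heuler, Nat.cast_prod]
    exact Finset.prod_congr rfl fun i _ =>
      (Nat.cast_pred (one_lt_index_coatomSubgroup e i).le).symm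
  refine ⟨⟨isGradedPoset_boundedCosetPoset hCompl e, fun x y hxy i hi => ?_⟩, hdim,
    fun i hi => ?_, ?_, hdual, ?_⟩
  · obtain ⟨m, b, hle, hsph⟩ := exists_isSpherical_Ioo ℂ hCompl e hxy
    rw [hsph, if_neg (by omega)]
  · rw [hbetti, if_neg hi]
  · rw [hbetti, if_pos rfl, hdual, heuler]
  · rw [heuler]
    exact Finset.prod_ne_zero_iff.2 fun i _ =>
      Nat.sub_ne_zero_of_lt (one_lt_index_coatomSubgroup e i)
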